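/- **Setting.** Let $\mathcal G$ be a connected simple graph on $m$ worker nodes whose edge set is partitioned into $M$ edge-disjoint matchings $\mathcal G_1,\dots,\mathcal G_M$ with Laplacians $\mathbf L_1,\dots,\mathbf L_M$. Let $C_b>0$ be a communication budget and let $p_1,\dots,p_M$ maximize the second smallest eigenvalue $\lambda_2\big(\sum_j p_j\mathbf L_j\big)$ subject to $\sum_j p_j\le C_bM$ and $0\le p_j\le 1$ (for $m=1$, where there is no second eigenvalue, any feasible $p$ is allowed). At iteration $k$ let $\mathsf B^{(k)}_j\sim\mathrm{Bernoulli}(p_j)$, $j=1,\dots,M$, be independent, and independent of everything drawn before and of the mini-batches of iteration $k$. For a weight $\alpha\in\mathbb R$ put $\mathbf W^{(k)}=\mathbf I-\alpha\sum_j\mathsf B^{(k)}_j\mathbf L_j$; these matrices are i.i.d. Let $\rho$ be the spectral norm (largest singular value) of $\mathbb E[\mathbf W^{(k)\top}\mathbf W^{(k)}]-\frac1m\mathbf 1\mathbf 1^\top$. **Algorithm.** Let $F_1,\dots,F_m:\mathbb R^d\to\mathbb R$ be local objectives, $F=\frac1m\sum_iF_i$, and $F(\mathbf x)\ge F_{\inf}$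 for all $\mathbf x$. All workers start at the same deterministic point $\mathbf x_i^{(1)}=\overline{\mathbf x}^{(1)}$, and with step size $\eta>0$ $$\mathbf x_i^{(k+1)}=\sum_{j=1}^mW^{(k)}_{ij}\big[\mathbf x_j^{(k)}-\eta\,g_j(\mathbf x_j^{(k)};\xi_j^{(k)})\big],\qquad \overline{\mathbf x}^{(k)}=\frac1m\sum_{i=1}^m\mathbf x_i^{(k)},$$ where $\xi_j^{(k)}$ is the random mini-batch and $g_j$ the stochastic gradient of worker $j$. Let $\mathcal F^{(k)}$ be the $\sigma$-algebra generated by all mini-batches and all activations of the iterations before $k$. Given $\mathcal F^{(k)}$, the $m$ stochastic gradients $g_i(\mathbf x_i^{(k)};\xi_i^{(k)})$ of iteration $k$ are independent. **Assumptions**, for all $i$, all $\mathbf x,\mathbf y\in\mathbb R^d$ and all $k\in\{1,\dots,K\}$, with constants $L\ge 0$, $\sigma$, $\zeta$: 1. $F_i$ is differentiable and $\|\nabla F_i(\mathbf x)-\nabla F_i(\mathbf y)\|\le L\|\mathbf x-\mathbf y\|$; 2. $\mathbb E[g_i(\mathbf x_i^{(k)};\xi_i^{(k)})\mid\mathcal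 F^{(k)}]=\nabla F_i(\mathbf x_i^{(k)})$; 3. $\mathbb E[\|g_i(\mathbf x_i^{(k)};\xi_i^{(k)})-\nabla F_i(\mathbf x_i^{(k)})\|^2\mid\mathcal F^{(k)}]\le\sigma^2$; 4. $\frac1m\sum_{i=1}^m\|\nabla F_i(\mathbf x)-\nabla F(\mathbf x)\|^2\le\zeta^2$. **Theorem.** (a) For every $C_b>0$ there is $\alpha_0>0$ such that $\rho<1$ for all $\alpha\in(0,\alpha_0)$. Moreover $\rho<1$ whenever $\alpha$ belongs to a solution $(r,\alpha,\beta)$ of the semidefinite program: minimize $r$ subject to $\alpha^2\le\beta$ and $\mathbf I-2\alpha\overline{\mathbf L}+\beta[\overline{\mathbf L}^2+2\widetilde{\mathbf L}]-\frac1m\mathbf 1\mathbf 1^\top\preceq r\mathbf I$, where $\overline{\mathbf L}=\sum_jp_j\mathbf L_j$ and $\widetilde{\mathbf L}=\sum_jp_j(1-p_j)\mathbf L_j$. (b) Let $\alpha$ be any weight with $\rho<1$, let $K\ge1$, and let $\eta L\le\min\{1,(\rho^{-1/2}-1)/4\}$ (with $\rho^{-1/2}=+\infty$ if $\rho=0$).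 Then $D:=6\eta^2L^2\rho/(1-\sqrt\rho)^2<\frac12$, the expectations below are finite, and $$\frac1K\sum_{k=1}^K\mathbb E\big[\|\nabla F(\overline{\mathbf x}^{(k)})\|^2\big]\le\Big(\frac{2[F(\overline{\mathbf x}^{(1)})-F_{\inf}]}{\eta K}+\frac{\eta L\sigma^2}{m}\Big)\frac1{1-2D}+\frac{2\eta^2L^2\rho}{1-\sqrt\rho}\Big(\frac{\sigma^2}{1+\sqrt\rho}+\frac{3\zeta^2}{1-\sqrt\rho}\Big)\frac1{1-2D}.$$ -/

import Mathlib

open MeasureTheory ProbabilityTheory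
open scoped Matrix

noncomputable section

namespace Matcha

/-! ### Graphs, matchings and mixing matrices -/

/-- A decomposition of the graph `G` into the edge-disjoint matchings `Gs 0, …, Gs (M - 1)`, all on
the same vertex set: together they give all edges of `G`, no edge lies in two of them, and in each
of them every vertex is incident with at most one edge. -/
structure IsMatchingDecomposition {m M : ℕ} (G : SimpleGraph (Fin m))
    (Gs : Fin M → SimpleGraph (Fin m)) : Prop where
  iSup_eq : ⨆ j, Gs j = G
  edge_disjoint : ∀ i j, i ≠ j → Disjoint (Gs i).edgeSet (Gs j).edgeSet
  matching : ∀ j v w w', (Gs j).Adj v w → (Gs j).Adj v w' → w = w'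

open Classical in
/-- The real Laplacian matrix (degree matrix minus adjacency matrix) of a graph. -/
def lap {m : ℕ} (G : SimpleGraph (Fin m)) : Matrix (Fin m) (Fin m) ℝ :=
  G.lapMatrix ℝ

/-- `𝟏𝟏ᵀ / m`. -/
def avgMatrix (m : ℕ) : Matrix (Fin m) (Fin m) ℝ :=
  Matrix.of fun _ _ => (1 : ℝ) / m

/-- The Laplacian `∑ⱼ pⱼ Lⱼ` of the expected activated graph. -/
def meanLap {m M : ℕ} (Gs : Fin M → SimpleGraph (Fin m)) (p : Fin M → unitInterval) :
    Matrix (Fin m) (Fin m) ℝ :=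
  ∑ j, (p j : ℝ) • lap (Gs j)

/-- The matrix `∑ⱼ pⱼ (1 - pⱼ) Lⱼ`. -/
def varLap {m M : ℕ} (Gs : Fin M → SimpleGraph (Fin m)) (p : Fin M → unitInterval) :
    Matrix (Fin m) (Fin m) ℝ :=
  ∑ j, ((p j : ℝ) * (1 - (p j : ℝ))) • lap (Gs j)

open Classical in
/-- The second smallest eigenvalue, counted with multiplicity, of a symmetric `m × m` matrix with
`2 ≤ m` (Mathlib's `eigenvalues₀` lists the eigenvalues in decreasing order). A `1 × 1` matrix has
no such eigenvalue and gets the value `0`. -/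
def lambda₂ {m : ℕ} (A : Matrix (Fin m) (Fin m) ℝ) : ℝ :=
  if h : A.IsHermitian ∧ 2 ≤ m then
    h.1.eigenvalues₀ ⟨m - 2, by rw [Fintype.card_fin]; have := h.2; omega⟩
  else 0

/-- `p` is a solution of the problem of choosing the activation probabilities: maximize
`λ₂(∑ⱼ pⱼ Lⱼ)` subject to `∑ⱼ pⱼ ≤ Cb · M` and `0 ≤ pⱼ ≤ 1`. -/
structure IsOptimalActivation {m M : ℕ} (Gs : Fin M → SimpleGraph (Fin m)) (Cb : ℝ)
    (p : Fin M → unitInterval) : Prop where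
  budget : ∑ j, (p j : ℝ) ≤ Cb * M
  optimal : ∀ q : Fin M → unitInterval, ∑ j, (q j : ℝ) ≤ Cb * M →
    lambda₂ (meanLap Gs q) ≤ lambda₂ (meanLap Gs p)

/-- The joint law of the `M` independent activation variables, the `j`-th of which is Bernoulli with
success probability `pⱼ`. -/
def activationLaw {M : ℕ} (p : Fin M → unitInterval) : Measure (Fin M → Bool) :=
  Measure.pi fun j => bernoulliMeasure true false (p j)

/-- The mixing matrix `I - α ∑ⱼ bⱼ Lⱼ` when the set of activated matchings is given by `b`. -/
def mixingMatrix {m M : ℕ} (Gs : Fin M → SimpleGraph (Fin m)) (α : ℝ) (b : Fin M → Bool) :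
    Matrix (Fin m) (Fin m) ℝ :=
  1 - α • ∑ j, (if b j then (1 : ℝ) else 0) • lap (Gs j)

/-- The (entrywise) expectation `E[Wᵀ W]` for the random mixing matrix `W = I - α ∑ⱼ Bⱼ Lⱼ`. -/
def expectedGram {m M : ℕ} (Gs : Fin M → SimpleGraph (Fin m)) (p : Fin M → unitInterval) (α : ℝ) :
    Matrix (Fin m) (Fin m) ℝ :=
  Matrix.of fun i i' =>
    ∫ b, ((mixingMatrix Gs α b)ᵀ * mixingMatrix Gs α b) i i' ∂(activationLaw p)

/-- The spectral norm `ρ` (largest singular value, i.e. operator norm for the Euclidean norm) of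
`E[Wᵀ W] - 𝟏𝟏ᵀ / m`. -/
def rho {m M : ℕ} (Gs : Fin M → SimpleGraph (Fin m)) (p : Fin M → unitInterval) (α : ℝ) : ℝ :=
  ‖Matrix.toEuclideanCLM (n := Fin m) (𝕜 := ℝ) (expectedGram Gs p α - avgMatrix m)‖

/-- Feasibility of `(r, α, β)` for the semidefinite program for the weight `α`: `α² ≤ β` and
`I - 2αL̄ + β(L̄² + 2L̃) - 𝟏𝟏ᵀ/m ⪯ r I`, where `L̄ = ∑ⱼ pⱼ Lⱼ` and `L̃ = ∑ⱼ pⱼ(1 - pⱼ) Lⱼ`. -/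
def SDPFeasible {m M : ℕ} (Gs : Fin M → SimpleGraph (Fin m)) (p : Fin M → unitInterval)
    (r α β : ℝ) : Prop :=
  α ^ 2 - β ≤ 0 ∧
    (r • (1 : Matrix (Fin m) (Fin m) ℝ) -
      (1 - (2 * α) • meanLap Gs p + β • (meanLap Gs p ^ 2 + (2 : ℝ) • varLap Gs p)
        - avgMatrix m)).PosSemidef

/-- `α` is the weight in a solution of the semidefinite program: minimize `r` over all feasible
`(r, α, β)`. -/
def IsOptimalWeight {m M : ℕ} (Gs : Fin M → SimpleGraph (Fin m)) (p : Fin M → unitInterval)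
    (α : ℝ) : Prop :=
  ∃ r β, SDPFeasible Gs p r α β ∧ ∀ r' α' β', SDPFeasible Gs p r' α' β' → r ≤ r'

/-! ### Decentralized SGD

Time starts at `0` here: `k = 0, …, K - 1` are the iterations that are usually numbered
`1, …, K`. -/

/-- The global objective `F = (1/m) ∑ᵢ Fᵢ`. -/
def globalObj {m d : ℕ} (F : Fin m → EuclideanSpace ℝ (Fin d) → ℝ)
    (x : EuclideanSpace ℝ (Fin d)) : ℝ :=
  (1 / (m : ℝ)) * ∑ i, F i x

/-- The local models of decentralized SGD, all initialized at `x₁`: worker `i` receives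
`xᵢ⁽ᵏ⁺¹⁾ = ∑ⱼ Wᵢⱼ⁽ᵏ⁾ (xⱼ⁽ᵏ⁾ - η gⱼ(xⱼ⁽ᵏ⁾; ξⱼ⁽ᵏ⁾))`. -/
def iterate {m d : ℕ} {Ω Ξ : Type*} (g : Fin m → EuclideanSpace ℝ (Fin d) → Ξ →
      EuclideanSpace ℝ (Fin d)) (η : ℝ) (x₁ : EuclideanSpace ℝ (Fin d))
    (W : ℕ → Ω → Matrix (Fin m) (Fin m) ℝ) (ξ : ℕ → Fin m → Ω → Ξ) :
    ℕ → Fin m → Ω → EuclideanSpace ℝ (Fin d)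
  | 0, _, _ => x₁
  | k + 1, i, ω => ∑ j, W k ω i j •
      (iterate g η x₁ W ξ k j ω - η • g j (iterate g η x₁ W ξ k j ω) (ξ k j ω))

/-- The average `(1/m) ∑ᵢ xᵢ` of the local models. -/
def average {m d : ℕ} (x : Fin m → EuclideanSpace ℝ (Fin d)) : EuclideanSpace ℝ (Fin d) :=
  (1 / (m : ℝ)) • ∑ i, x i

/-- The σ-algebra generated by all mini-batches drawn before iteration `k` and all activations
before iteration `k`. -/
abbrev history {m M : ℕ} {Ω Ξ : Type*} [MeasurableSpace Ξ] (ξ : ℕ → Fin m → Ω → Ξ)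
    (B : ℕ → Ω → Fin M → Bool) (k : ℕ) : MeasurableSpace Ω :=
  ⨆ l ∈ Finset.range k,
    (⨆ i, MeasurableSpace.comap (ξ l i) inferInstance) ⊔
      MeasurableSpace.comap (B l) inferInstance

/-- The σ-algebra generated by the history before iteration `k` and the mini-batches of
iteration `k`. -/
abbrev historyWithSamples {m M : ℕ} {Ω Ξ : Type*} [MeasurableSpace Ξ] (ξ : ℕ → Fin m → Ω → Ξ)
    (B : ℕ → Ω → Fin M → Bool) (k : ℕ) : MeasurableSpace Ω :=
  history ξ B k ⊔ ⨆ i, MeasurableSpace.comap (ξ k i) inferInstance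

/-- Conditional independence of finitely many random variables given a σ-algebra `𝓕`: almost surely
`P(X₁ ∈ s₁, …, Xₘ ∈ sₘ | 𝓕) = ∏ᵢ P(Xᵢ ∈ sᵢ | 𝓕)`. Mathlib's `iCondIndepFun` is the same notion, but
it is defined only on standard Borel sample spaces. -/
def CondIndepGiven {m : ℕ} {Ω E : Type*} [MeasurableSpace E] {mΩ : MeasurableSpace Ω}
    (P : Measure Ω) (𝓕 : MeasurableSpace Ω) (X : Fin m → Ω → E) : Prop :=
  ∀ s : Fin m → Set E, (∀ i, MeasurableSet (s i)) →
    P⟦⋂ i, X i ⁻¹' s i | 𝓕⟧ =ᵐ[P] ∏ i, P⟦X i ⁻¹' s i | 𝓕⟧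

end Matcha

end

/-!
Everything rests on the identity `E[WᵀW] - 𝟏𝟏ᵀ/m = I - 2αL̄ + α²(L̄² + 2L̃) - 𝟏𝟏ᵀ/m`
(`expectedGram_eq`), which uses that the activations are independent and that the Laplacian of a
matching squares to twice itself. The matrix is positive semidefinite, so `ρ` is at most any `r`
for which it is `⪯ r I`, and `ρ < 1` as soon as some `r < 1` works.

**Small weights and the semidefinite program.** Activating all matchings with one and the same
positive probability is feasible and has positive algebraic connectivity, because `G` is connected.
Hence the optimal probabilities have it as well, the kernel of `L̄` consists of the constants, and
`L̄ + 𝟏𝟏ᵀ/m ⪰ c I` with `c > 0`. The term linear in `α` then dominates the quadratic one for small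
`α > 0`, which gives feasible points `(r, α, α²)` with `r < 1` (`exists_forall_sdpFeasible`). In
particular the optimal value of the program is below `1`; replacing `β` by `α²` decreases the
constrained matrix, so `ρ` is at most this value (`rho_lt_one_of_sdpFeasible`).

**Convergence.** The averaged model performs a gradient step with the averaged stochastic gradient,
since mixing preserves averages. The descent lemma gives the expected decrease of `F` up to the
variance `σ²/m` (the noises of different workers are uncorrelated) and `L²/m` times the expected
consensus error `Yₖ = E ∑ᵢ ‖xᵢ - x̄‖²` (`IsNoisyVersion.integral_globalObj_le`). The consensus error
is controlled by a one-step recursion: mixing multiplies it by `ρ` in expectation, the noise is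
orthogonal to the past, and Young's inequality gives
`Yₖ₊₁ ≤ √ρ Yₖ + ρ/(1 - √ρ) η² E ∑ᵢ ‖∇Fᵢ(xᵢ)‖² + ρ η² m σ²`
(`IsNoisyVersion.integral_dispersion_mixing_le`). Both inequalities are summed over the iterations
and combined in `average_le_of_recursion`. The recursion avoids products of mixing matrices, and
its constants are at least as good as those of the claimed bound.

The one step that is not routine probability is `CondIndepGiven.integral_inner_sub_eq_zero`, which
passes from conditional independence of events to vanishing correlation of vectors without regular
conditional distributions.
-/

namespace Matcha

/-! ### Laplacians of matchings -/

lemma lap_isHermitian {m : ℕ} (G : SimpleGraph (Fin m)) : (lap G).IsHermitian := by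
  classical
  exact G.isHermitian_lapMatrix ℝ

lemma lap_posSemidef {m : ℕ} (G : SimpleGraph (Fin m)) : (lap G).PosSemidef := by
  classical
  exact G.posSemidef_lapMatrix ℝ

lemma lap_mulVec_one {m : ℕ} (G : SimpleGraph (Fin m)) : lap G *ᵥ (fun _ => 1) = 0 := by
  classical
  exact G.lapMatrix_mulVec_const_eq_zero

/-- The Laplacian of a matching squares to twice itself: each matched pair contributes a block
`!![1, -1; -1, 1]`. -/
lemma lap_mul_self {m : ℕ} (G : SimpleGraph (Fin m))
    (h : ∀ v w w', G.Adj v w → G.Adj v w' → w = w') : lap G * lap G = (2 : ℝ) • lap G := by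
  classical
  have key : ∀ (x : Fin m → ℝ) (v : Fin m),
      (lap G *ᵥ x) v = ∑ w ∈ G.neighborFinset v, (x v - x w) := by
    intro x v
    have := G.lapMatrix_mulVec_apply (R := ℝ) v x
    simp only [lap]
    rw [this, Finset.sum_sub_distrib]
    simp
  have single : ∀ v w, G.Adj v w → G.neighborFinset v = {w} := by
    intro v w hvw
    ext u
    simp only [SimpleGraph.mem_neighborFinset, Finset.mem_singleton]
    exact ⟨fun hu => h v u w hu hvw, fun hu => hu ▸ hvw⟩
  apply Matrix.mulVec_injective
  funext x
  rw [← Matrix.mulVec_mulVec, Matrix.smul_mulVec]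
  funext v
  rw [Pi.smul_apply, key (lap G *ᵥ x) v, key x v, Finset.smul_sum]
  refine Finset.sum_congr rfl fun w hw => ?_
  have hvw : G.Adj v w := by simpa using hw
  rw [key, single v w hvw, single w v hvw.symm, Finset.sum_singleton, Finset.sum_singleton,
    smul_eq_mul]
  ring

lemma const_of_lap_mulVec_eq_zero {m : ℕ} {G : SimpleGraph (Fin m)} {x : Fin m → ℝ}
    (h : lap G *ᵥ x = 0) {v w : Fin m} (hvw : G.Adj v w) : x v = x w := by
  classical
  have := (G.lapMatrix_mulVec_eq_zero_iff_forall_adj (x := x)).1 h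
  exact this v w hvw

section Weighted

variable {m M : ℕ} (Gs : Fin M → SimpleGraph (Fin m))

/-- The combination `∑ⱼ cⱼ Lⱼ` of the Laplacians of the matchings; `L̄` and `L̃` are of this form,
and so is the Laplacian of the activated graph. -/
noncomputable def weightedLap (c : Fin M → ℝ) : Matrix (Fin m) (Fin m) ℝ := ∑ j, c j • lap (Gs j)

lemma weightedLap_isHermitian (c : Fin M → ℝ) : (weightedLap Gs c).IsHermitian := by
  unfold weightedLap
  simp only [Matrix.IsHermitian, Matrix.conjTranspose_sum, Matrix.conjTranspose_smul, star_trivial]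
  exact Finset.sum_congr rfl fun j _ => by rw [(lap_isHermitian (Gs j)).eq]

lemma weightedLap_transpose (c : Fin M → ℝ) : (weightedLap Gs c)ᵀ = weightedLap Gs c := by
  simpa [Matrix.IsHermitian, Matrix.conjTranspose_eq_transpose_of_trivial] using
    weightedLap_isHermitian Gs c

lemma weightedLap_posSemidef {c : Fin M → ℝ} (hc : ∀ j, 0 ≤ c j) :
    (weightedLap Gs c).PosSemidef :=
  Matrix.posSemidef_sum _ fun j _ => (lap_posSemidef (Gs j)).smul (hc j)

lemma weightedLap_mulVec_one (c : Fin M → ℝ) : weightedLap Gs c *ᵥ (fun _ => 1) = 0 := by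
  unfold weightedLap
  rw [Matrix.sum_mulVec]
  exact Finset.sum_eq_zero fun j _ => by rw [Matrix.smul_mulVec, lap_mulVec_one, smul_zero]

lemma avgMatrix_mulVec (x : Fin m → ℝ) : avgMatrix m *ᵥ x = fun _ => (1 / (m : ℝ)) * ∑ i, x i := by
  funext i
  simp [avgMatrix, Matrix.mulVec, dotProduct, Finset.mul_sum]

lemma avgMatrix_transpose : (avgMatrix m)ᵀ = avgMatrix m := by
  ext i j
  simp [avgMatrix]

lemma weightedLap_mul_avgMatrix (c : Fin M → ℝ) : weightedLap Gs c * avgMatrix m = 0 := by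
  apply Matrix.mulVec_injective
  funext x
  rw [← Matrix.mulVec_mulVec, avgMatrix_mulVec, Matrix.zero_mulVec]
  have : (fun _ : Fin m => (1 / (m : ℝ)) * ∑ i, x i) =
      ((1 / (m : ℝ)) * ∑ i, x i) • (fun _ : Fin m => (1 : ℝ)) := by
    funext; simp
  rw [this, Matrix.mulVec_smul, weightedLap_mulVec_one, smul_zero]

lemma avgMatrix_mul_weightedLap (c : Fin M → ℝ) : avgMatrix m * weightedLap Gs c = 0 := by
  have := congrArg Matrix.transpose (weightedLap_mul_avgMatrix Gs c)
  rwa [Matrix.transpose_mul, weightedLap_transpose, avgMatrix_transpose, Matrix.transpose_zero]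
    at this

lemma avgMatrix_mul_self [NeZero m] : avgMatrix m * avgMatrix m = avgMatrix m := by
  have hm : (m : ℝ) ≠ 0 := Nat.cast_ne_zero.2 (NeZero.ne m)
  ext i j
  simp only [avgMatrix, Matrix.mul_apply, Matrix.of_apply, Finset.sum_const, Finset.card_univ,
    Fintype.card_fin, nsmul_eq_mul]
  field_simp

lemma dotProduct_avgMatrix (x : Fin m → ℝ) :
    x ⬝ᵥ avgMatrix m *ᵥ x = (1 / (m : ℝ)) * (∑ i, x i) ^ 2 := by
  rw [avgMatrix_mulVec]
  simp only [dotProduct]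
  rw [← Finset.sum_mul]
  ring

lemma dotProduct_avgMatrix_nonneg (x : Fin m → ℝ) : 0 ≤ x ⬝ᵥ avgMatrix m *ᵥ x := by
  rw [dotProduct_avgMatrix]
  positivity

/-- If all weights are positive, the kernel of the weighted Laplacian of a connected graph consists
of the constant vectors. -/
lemma const_of_weightedLap_mulVec_eq_zero {G : SimpleGraph (Fin m)} (hG : G.Connected)
    (hGs : ⨆ j, Gs j = G) {c : Fin M → ℝ} (hc : ∀ j, 0 < c j) {x : Fin m → ℝ}
    (hx : weightedLap Gs c *ᵥ x = 0) (v w : Fin m) : x v = x w := by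
  have hquad : ∑ j, x ⬝ᵥ (c j • lap (Gs j)) *ᵥ x = 0 := by
    rw [← dotProduct_sum, ← Matrix.sum_mulVec]
    change x ⬝ᵥ weightedLap Gs c *ᵥ x = 0
    rw [hx, dotProduct_zero]
  have hps : ∀ j, (c j • lap (Gs j)).PosSemidef := fun j => (lap_posSemidef (Gs j)).smul (hc j).le
  have hz := (Finset.sum_eq_zero_iff_of_nonneg fun j _ => by
    simpa using (hps j).dotProduct_mulVec_nonneg x).1 hquad
  have hadj : ∀ a b, G.Adj a b → x a = x b := by
    intro a b hab
    rw [← hGs, SimpleGraph.iSup_adj] at hab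
    obtain ⟨j, hj⟩ := hab
    have h1 : (c j • lap (Gs j)) *ᵥ x = 0 :=
      ((hps j).dotProduct_mulVec_zero_iff x).1 (by simpa using hz j (Finset.mem_univ j))
    rw [Matrix.smul_mulVec] at h1
    exact const_of_lap_mulVec_eq_zero ((smul_eq_zero.1 h1).resolve_left (hc j).ne') hj
  obtain ⟨p⟩ := hG.preconnected v w
  induction p with
  | nil => rfl
  | cons h _ ih => exact (hadj _ _ h).trans ih

end Weighted

/-! ### The second smallest eigenvalue -/

/-- The second smallest eigenvalue of a positive semidefinite matrix is positive exactly when at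
most one eigenvalue vanishes, that is, when the rank is at least `m - 1`. -/
lemma lambda₂_pos_iff {m : ℕ} (hm : 2 ≤ m) {A : Matrix (Fin m) (Fin m) ℝ} (hA : A.PosSemidef) :
    0 < lambda₂ A ↔ m - 1 ≤ A.rank := by
  classical
  set e := hA.isHermitian.eigenvalues₀ with he
  have hanti : Antitone e := hA.isHermitian.eigenvalues₀_antitone
  let eqv : Fin (Fintype.card (Fin m)) ≃ Fin m := Fintype.equivOfCardEq (Fintype.card_fin _)
  have hnn : ∀ i, 0 ≤ e i := by
    intro i
    have := hA.eigenvalues_nonneg (eqv i)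
    have h2 : hA.isHermitian.eigenvalues (eqv i) = e (eqv.symm (eqv i)) := rfl
    rwa [h2, Equiv.symm_apply_apply] at this
  have hcard : Fintype.card (Fin m) = m := Fintype.card_fin m
  have hrank : A.rank = (Finset.univ.filter fun i => e i ≠ 0).card := by
    rw [hA.isHermitian.rank_eq_card_non_zero_eigs, ← Fintype.card_subtype]
    exact Fintype.card_congr ((eqv.symm.subtypeEquiv fun i => Iff.rfl))
  have hl : lambda₂ A = e ⟨m - 2, by omega⟩ := by
    unfold lambda₂
    rw [dif_pos ⟨hA.isHermitian, hm⟩]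
  rw [hl, hrank]
  constructor
  · intro hpos
    have hsub : (Finset.univ.filter fun i : Fin (Fintype.card (Fin m)) => (i : ℕ) < m - 1) ⊆
        Finset.univ.filter fun i => e i ≠ 0 := by
      intro i hi
      simp only [Finset.mem_filter, Finset.mem_univ, true_and] at hi ⊢
      exact (hpos.trans_le (hanti (Fin.mk_le_mk.2 (by omega) : i ≤ ⟨m - 2, by omega⟩))).ne'
    refine le_trans (le_of_eq ?_) (Finset.card_le_card hsub)
    rw [Fin.card_filter_val_lt]
    omega
  · intro hle
    by_contra hneg
    have hsub : (Finset.univ.filter fun i => e i ≠ 0) ⊆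
        Finset.univ.filter fun i : Fin (Fintype.card (Fin m)) => (i : ℕ) < m - 2 := by
      intro i hi
      simp only [Finset.mem_filter, Finset.mem_univ, true_and] at hi ⊢
      by_contra hge
      have h1 : e i ≤ e ⟨m - 2, by omega⟩ := hanti (Fin.mk_le_mk.2 (by omega))
      exact hi (le_antisymm (h1.trans (not_lt.1 hneg)) (hnn i))
    have := Finset.card_le_card hsub
    rw [Fin.card_filter_val_lt] at this
    omega

/-- For a positive semidefinite matrix that annihilates `𝟏`, the second smallest eigenvalue is
positive exactly when the kernel consists of the constant vectors. -/
lemma lambda₂_pos_iff_ker {m : ℕ} (hm : 2 ≤ m) {A : Matrix (Fin m) (Fin m) ℝ} (hA : A.PosSemidef)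
    (h1 : A *ᵥ (fun _ => 1) = 0) :
    0 < lambda₂ A ↔ ∀ x, A *ᵥ x = 0 → ∀ v w, x v = x w := by
  have hrn := LinearMap.finrank_range_add_finrank_ker A.mulVecLin
  rw [Module.finrank_fin_fun] at hrn
  have hone : (fun _ : Fin m => (1 : ℝ)) ≠ 0 := fun h => one_ne_zero (congrFun h ⟨0, by omega⟩)
  have hmem : (fun _ : Fin m => (1 : ℝ)) ∈ LinearMap.ker A.mulVecLin := by
    simpa [LinearMap.mem_ker] using h1
  have hle : m - 1 ≤ A.rank ↔ Module.finrank ℝ (LinearMap.ker A.mulVecLin) ≤ 1 := by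
    unfold Matrix.rank
    omega
  rw [lambda₂_pos_iff hm hA, hle]
  constructor
  · intro hf x hx v w
    obtain ⟨u, hu⟩ := finrank_le_one_iff.1 hf
    obtain ⟨a, ha⟩ := hu ⟨_, hmem⟩
    obtain ⟨b, hb⟩ := hu ⟨x, by simpa [LinearMap.mem_ker] using hx⟩
    have ha' : ∀ i, a * (u : Fin m → ℝ) i = 1 := fun i => congrFun (congrArg Subtype.val ha) i
    have hb' : ∀ i, b * (u : Fin m → ℝ) i = x i := fun i => congrFun (congrArg Subtype.val hb) i
    have ha0 : a ≠ 0 := fun h => by simpa [h] using ha' v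
    have : (u : Fin m → ℝ) v = (u : Fin m → ℝ) w :=
      mul_left_cancel₀ ha0 ((ha' v).trans (ha' w).symm)
    rw [← hb', ← hb', this]
  · intro h
    refine finrank_le_one ⟨_, hmem⟩ fun x => ⟨(x : Fin m → ℝ) ⟨0, by omega⟩, ?_⟩
    apply Subtype.ext
    funext v
    simpa using h x (LinearMap.mem_ker.1 x.2) _ v

/-- Optimal activation probabilities give an expected graph whose Laplacian vanishes only on
constants: activating every matching with the same positive probability is feasible and already has
positive algebraic connectivity. -/
lemma IsOptimalActivation.const_of_meanLap_mulVec_eq_zero {m M : ℕ} {G : SimpleGraph (Fin m)}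
    (hG : G.Connected) {Gs : Fin M → SimpleGraph (Fin m)} (hGs : ⨆ j, Gs j = G)
    {Cb : ℝ} (hCb : 0 < Cb) {p : Fin M → unitInterval} (hp : IsOptimalActivation Gs Cb p)
    {x : Fin m → ℝ} (hx : meanLap Gs p *ᵥ x = 0) (v w : Fin m) : x v = x w := by
  rcases lt_or_ge m 2 with hm | hm
  · have : Subsingleton (Fin m) := by
      rw [Fin.subsingleton_iff_le_one]; omega
    rw [Subsingleton.elim v w]
  have hq0 : 0 < min 1 Cb := lt_min one_pos hCb
  let q : Fin M → unitInterval := fun _ => ⟨min 1 Cb, hq0.le, min_le_left _ _⟩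
  have hfeas : ∑ j, (q j : ℝ) ≤ Cb * M := by
    simp only [q, Finset.sum_const, Finset.card_univ, Fintype.card_fin, nsmul_eq_mul]
    rw [mul_comm]
    exact mul_le_mul_of_nonneg_right (min_le_right _ _) (Nat.cast_nonneg _)
  have hps : ∀ r : Fin M → unitInterval, (meanLap Gs r).PosSemidef := fun r =>
    weightedLap_posSemidef Gs fun j => (r j).2.1
  have hpos : 0 < lambda₂ (meanLap Gs q) :=
    (lambda₂_pos_iff_ker hm (hps q) (weightedLap_mulVec_one Gs _)).2 fun y hy =>
      const_of_weightedLap_mulVec_eq_zero Gs hG hGs (fun _ => hq0) hy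
  exact (lambda₂_pos_iff_ker hm (hps p) (weightedLap_mulVec_one Gs _)).1
    (hpos.trans_le (hp.optimal q hfeas)) x hx v w

/-! ### The expected Gram matrix -/

section Activation

variable {M : ℕ} (p : Fin M → unitInterval)

instance isProbabilityMeasure_activationLaw : IsProbabilityMeasure (activationLaw p) := by
  unfold activationLaw
  infer_instance

lemma integrable_activationLaw (f : (Fin M → Bool) → ℝ) : Integrable f (activationLaw p) :=
  Integrable.of_finite

lemma integral_activation (j : Fin M) :
    ∫ b, (if b j then (1 : ℝ) else 0) ∂(activationLaw p) = p j := by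
  refine (integral_comp_eval (μ := fun j => bernoulliMeasure true false (p j)) (i := j)
    (f := fun b : Bool => if b then (1 : ℝ) else 0)
    (measurable_of_finite _).aestronglyMeasurable).trans ?_
  rw [integral_bernoulliMeasure]
  simp

lemma integral_activation_mul {j l : Fin M} (hjl : j ≠ l) :
    ∫ b, (if b j then (1 : ℝ) else 0) * (if b l then (1 : ℝ) else 0) ∂(activationLaw p) =
      p j * p l := by
  have h := integral_fintype_prod_eq_prod (𝕜 := ℝ)
    (μ := fun j => bernoulliMeasure true false (p j))
    (fun i (b : Bool) => if i = j ∨ i = l then (if b then (1 : ℝ) else 0) else 1)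
  rw [Finset.prod_eq_mul j l hjl (by
    intro i _ hi
    simp only [hi.1, hi.2, or_self, if_false]
    simp) (by simp) (by simp)] at h
  simp only [true_or, or_true, if_true, integral_bernoulliMeasure] at h
  simp only [Bool.false_eq_true, if_false, smul_eq_mul, mul_one, mul_zero, add_zero] at h
  rw [← h]
  unfold activationLaw
  congr 1
  funext b
  rw [Finset.prod_eq_mul j l hjl (fun i _ hi => by simp [hi.1, hi.2]) (by simp) (by simp)]
  simp

end Activation

section Gram

variable {m M : ℕ} {Gs : Fin M → SimpleGraph (Fin m)} {p : Fin M → unitInterval} {α : ℝ}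

lemma mixingMatrix_eq (b : Fin M → Bool) :
    mixingMatrix Gs α b = 1 - α • weightedLap Gs (fun j => if b j then 1 else 0) := rfl

lemma mixingMatrix_transpose (b : Fin M → Bool) :
    (mixingMatrix Gs α b)ᵀ = mixingMatrix Gs α b := by
  rw [mixingMatrix_eq, Matrix.transpose_sub, Matrix.transpose_smul, weightedLap_transpose,
    Matrix.transpose_one]

lemma weightedLap_mul_self (c : Fin M → ℝ) : weightedLap Gs c * weightedLap Gs c =
    ∑ j, ∑ l, (c j * c l) • (lap (Gs j) * lap (Gs l)) := by
  unfold weightedLap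
  rw [Finset.sum_mul_sum]
  simp only [Matrix.smul_mul, Matrix.mul_smul, smul_smul, mul_comm]

/-- `E[WᵀW] = I - 2αL̄ + α²(L̄² + 2L̃)`: independence gives the product of the means off the
diagonal of the double sum, and on it `Bⱼ² = Bⱼ` and `Lⱼ² = 2Lⱼ`. -/
lemma expectedGram_eq (hGs : ∀ j v w w', (Gs j).Adj v w → (Gs j).Adj v w' → w = w') :
    expectedGram Gs p α = 1 - (2 * α) • meanLap Gs p +
      α ^ 2 • (meanLap Gs p ^ 2 + (2 : ℝ) • varLap Gs p) := by
  have hW : ∀ b, (mixingMatrix Gs α b)ᵀ * mixingMatrix Gs α b =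
      1 - (2 * α) • ∑ j, (if b j then (1 : ℝ) else 0) • lap (Gs j) +
      α ^ 2 • ∑ j, ∑ l, ((if b j then (1 : ℝ) else 0) * (if b l then (1 : ℝ) else 0)) •
        (lap (Gs j) * lap (Gs l)) := by
    intro b
    rw [mixingMatrix_transpose, mixingMatrix_eq, ← weightedLap_mul_self]
    change _ = 1 - (2 * α) • weightedLap Gs _ + _
    simp only [sub_mul, mul_sub, one_mul, mul_one, Matrix.smul_mul, Matrix.mul_smul, smul_smul]
    module
  have hsq : meanLap Gs p ^ 2 + (2 : ℝ) • varLap Gs p =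
      ∑ j, ∑ l, (if j = l then (p j : ℝ) else p j * p l) • (lap (Gs j) * lap (Gs l)) := by
    have h1 : meanLap Gs p ^ 2 = _ :=
      (sq _).trans (weightedLap_mul_self (Gs := Gs) fun j => (p j : ℝ))
    have h2 : (2 : ℝ) • varLap Gs p = ∑ j, ∑ l,
        (if j = l then (p j : ℝ) * (1 - p j) else 0) • (lap (Gs j) * lap (Gs l)) := by
      unfold varLap
      rw [Finset.smul_sum]
      refine Finset.sum_congr rfl fun j _ => ?_
      simp only [ite_smul, zero_smul, Finset.sum_ite_eq, Finset.mem_univ, if_true]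
      rw [lap_mul_self _ (hGs j), smul_comm]
    rw [h1, h2]
    simp only [← Finset.sum_add_distrib, ← add_smul]
    refine Finset.sum_congr rfl fun j _ => Finset.sum_congr rfl fun l _ => ?_
    congr 1
    split_ifs with h
    · subst h; ring
    · ring
  have hmom : ∀ j l, ∫ b, (if b j then (1 : ℝ) else 0) * (if b l then (1 : ℝ) else 0)
      ∂(activationLaw p) = if j = l then (p j : ℝ) else p j * p l := by
    intro j l
    split_ifs with h
    · subst h
      rw [← integral_activation p j]
      congr 1
      funext b
      split_ifs <;> simp
    · exact integral_activation_mul p h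
  rw [hsq]
  ext i i'
  simp only [expectedGram, Matrix.of_apply, hW, Matrix.add_apply, Matrix.sub_apply,
    Matrix.smul_apply, Matrix.sum_apply, smul_eq_mul, meanLap]
  rw [integral_add (integrable_activationLaw p _) (integrable_activationLaw p _),
    integral_sub (integrable_activationLaw p _) (integrable_activationLaw p _),
    integral_const_mul, integral_const_mul,
    integral_finsetSum _ fun _ _ => integrable_activationLaw p _,
    integral_finsetSum _ fun _ _ => integrable_activationLaw p _]
  simp only [integral_const, probReal_univ, one_smul]
  congr 2
  · congr 1
    refine Finset.sum_congr rfl fun j _ => ?_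
    rw [integral_mul_const, integral_activation]
  · refine Finset.sum_congr rfl fun j _ => ?_
    rw [integral_finsetSum _ fun _ _ => integrable_activationLaw p _]
    refine Finset.sum_congr rfl fun l _ => ?_
    rw [integral_mul_const, hmom]

lemma meanLap_eq : meanLap Gs p = weightedLap Gs fun j => (p j : ℝ) := rfl

lemma varLap_posSemidef : (varLap Gs p).PosSemidef :=
  weightedLap_posSemidef Gs fun j => mul_nonneg (p j).2.1 (sub_nonneg.2 (p j).2.2)

lemma sq_posSemidef {A : Matrix (Fin m) (Fin m) ℝ} (hA : Aᵀ = A) : (A ^ 2).PosSemidef := by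
  have := Matrix.posSemidef_conjTranspose_mul_self A
  rwa [Matrix.conjTranspose_eq_transpose_of_trivial, hA, ← sq] at this

lemma meanLap_sq_add_varLap_posSemidef :
    (meanLap Gs p ^ 2 + (2 : ℝ) • varLap Gs p).PosSemidef :=
  (sq_posSemidef (weightedLap_transpose Gs _)).add (varLap_posSemidef.smul zero_le_two)

/-- `E[WᵀW] - 𝟏𝟏ᵀ/m = (I - αL̄ - 𝟏𝟏ᵀ/m)² + 2α²L̃` is positive semidefinite. -/
lemma expectedGram_sub_avgMatrix_posSemidef [NeZero m]
    (hGs : ∀ j v w w', (Gs j).Adj v w → (Gs j).Adj v w' → w = w') :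
    (expectedGram Gs p α - avgMatrix m).PosSemidef := by
  have h : expectedGram Gs p α - avgMatrix m =
      (1 - α • meanLap Gs p - avgMatrix m) ^ 2 + (α ^ 2 * 2) • varLap Gs p := by
    rw [expectedGram_eq hGs, meanLap_eq]
    simp only [sq (1 - α • weightedLap Gs _ - avgMatrix m), sub_mul, mul_sub, one_mul, mul_one,
      Matrix.smul_mul, Matrix.mul_smul, smul_smul, weightedLap_mul_avgMatrix,
      avgMatrix_mul_weightedLap, avgMatrix_mul_self, sq (weightedLap Gs _)]
    module
  rw [h]
  refine (sq_posSemidef ?_).add (varLap_posSemidef.smul (by positivity))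
  rw [Matrix.transpose_sub, Matrix.transpose_sub, Matrix.transpose_one, Matrix.transpose_smul,
    avgMatrix_transpose, meanLap_eq, weightedLap_transpose]

end Gram

/-! ### The spectral norm of the expected Gram matrix -/

/-- Quadratic forms are bounded by the operator norm. -/
lemma dotProduct_mulVec_le_norm {m : ℕ} (A : Matrix (Fin m) (Fin m) ℝ) (x : Fin m → ℝ) :
    x ⬝ᵥ A *ᵥ x ≤ ‖Matrix.toEuclideanCLM (n := Fin m) (𝕜 := ℝ) A‖ * (x ⬝ᵥ x) := by
  have h := real_inner_le_norm (WithLp.toLp 2 x)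
    (Matrix.toEuclideanCLM (n := Fin m) (𝕜 := ℝ) A (WithLp.toLp 2 x))
  rw [Matrix.inner_toEuclideanCLM] at h
  have h2 := (Matrix.toEuclideanCLM (n := Fin m) (𝕜 := ℝ) A).le_opNorm (WithLp.toLp 2 x)
  have h3 : ‖WithLp.toLp 2 x‖ * ‖WithLp.toLp 2 x‖ = x ⬝ᵥ x := by
    rw [← sq, EuclideanSpace.real_norm_sq_eq]
    simp [dotProduct, sq]
  calc x ⬝ᵥ A *ᵥ x ≤ _ := h
    _ ≤ ‖WithLp.toLp 2 x‖ * (‖Matrix.toEuclideanCLM (n := Fin m) (𝕜 := ℝ) A‖ *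
        ‖WithLp.toLp 2 x‖) := mul_le_mul_of_nonneg_left h2 (norm_nonneg _)
    _ = _ := by rw [← h3]; ring

/-- If `0 ⪯ A ⪯ r I` with `0 < r`, then `‖A‖ ≤ r`. The bound `A² ⪯ r A` comes from
`r (r A - A²) = A (r - A) A + (r - A) A (r - A)`. -/
lemma norm_toEuclideanCLM_le {m : ℕ} {A : Matrix (Fin m) (Fin m) ℝ} {r : ℝ} (hr : 0 < r)
    (hA : A.PosSemidef) (hrA : (r • (1 : Matrix (Fin m) (Fin m) ℝ) - A).PosSemidef) :
    ‖Matrix.toEuclideanCLM (n := Fin m) (𝕜 := ℝ) A‖ ≤ r := by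
  have hkey : ((r * r) • A - r • (A * A)).PosSemidef := by
    have h1 := hrA.conjTranspose_mul_mul_same A
    have h2 := hA.conjTranspose_mul_mul_same (r • (1 : Matrix (Fin m) (Fin m) ℝ) - A)
    rw [hA.isHermitian.eq] at h1
    rw [hrA.isHermitian.eq] at h2
    have h3 := h1.add h2
    have : A * (r • (1 : Matrix (Fin m) (Fin m) ℝ) - A) * A +
        (r • (1 : Matrix (Fin m) (Fin m) ℝ) - A) * A * (r • (1 : Matrix (Fin m) (Fin m) ℝ) - A) =
        (r * r) • A - r • (A * A) := by
      simp only [sub_mul, mul_sub, one_mul, mul_one, Matrix.smul_mul, Matrix.mul_smul, smul_smul,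
        Matrix.mul_assoc]
      module
    rwa [this] at h3
  refine ContinuousLinearMap.opNorm_le_bound _ hr.le fun x => ?_
  have e1 := hkey.dotProduct_mulVec_nonneg x.ofLp
  have e2 := hrA.dotProduct_mulVec_nonneg x.ofLp
  simp only [star_trivial, Matrix.sub_mulVec, Matrix.smul_mulVec, dotProduct_sub, dotProduct_smul,
    smul_eq_mul, Matrix.one_mulVec] at e1 e2
  have hAT : Aᵀ = A := by
    rw [← Matrix.conjTranspose_eq_transpose_of_trivial, hA.isHermitian.eq]
  have e3 : x.ofLp ⬝ᵥ (A * A) *ᵥ x.ofLp =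
      ‖Matrix.toEuclideanCLM (n := Fin m) (𝕜 := ℝ) A x‖ ^ 2 := by
    rw [EuclideanSpace.real_norm_sq_eq, ← Matrix.mulVec_mulVec, Matrix.dotProduct_mulVec,
      ← Matrix.mulVec_transpose, hAT]
    simp [dotProduct, sq]
  have e4 : x.ofLp ⬝ᵥ x.ofLp = ‖x‖ ^ 2 := by
    rw [EuclideanSpace.real_norm_sq_eq]
    simp [dotProduct, sq]
  rw [e3] at e1
  rw [e4] at e2
  refine abs_le_of_sq_le_sq' ?_ (by positivity) |>.2
  rw [mul_pow]
  refine le_of_mul_le_mul_left ?_ hr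
  nlinarith [mul_nonneg (mul_nonneg hr.le hr.le) e2]

/-- If `0 ⪯ A ⪯ r I` with `r < 1`, then `‖A‖ < 1`. -/
lemma norm_toEuclideanCLM_lt_one {m : ℕ} {A : Matrix (Fin m) (Fin m) ℝ} {r : ℝ} (hr : r < 1)
    (hA : A.PosSemidef) (hrA : (r • (1 : Matrix (Fin m) (Fin m) ℝ) - A).PosSemidef) :
    ‖Matrix.toEuclideanCLM (n := Fin m) (𝕜 := ℝ) A‖ < 1 := by
  have h : (max r (1 / 2) • (1 : Matrix (Fin m) (Fin m) ℝ) - A).PosSemidef := by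
    have := hrA.add (Matrix.PosSemidef.one.smul (sub_nonneg.2 (le_max_left r (1 / 2))))
    convert this using 1
    module
  exact (norm_toEuclideanCLM_le (lt_max_of_lt_right (by norm_num)) hA h).trans_lt
    (max_lt hr (by norm_num))

lemma exists_pos_le_dotProduct_mulVec {m : ℕ} [NeZero m] {A : Matrix (Fin m) (Fin m) ℝ}
    (hA : A.PosDef) : ∃ c : ℝ, 0 < c ∧ ∀ x : Fin m → ℝ, c * (x ⬝ᵥ x) ≤ x ⬝ᵥ A *ᵥ x := by
  set f : EuclideanSpace ℝ (Fin m) → ℝ := fun x => x.ofLp ⬝ᵥ A *ᵥ x.ofLp with hf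
  have hcont : Continuous f := by
    simp only [hf, dotProduct, Matrix.mulVec]
    fun_prop
  have hne : (Metric.sphere (0 : EuclideanSpace ℝ (Fin m)) 1).Nonempty :=
    NormedSpace.sphere_nonempty.2 zero_le_one
  obtain ⟨u, hu, hmin⟩ := (isCompact_sphere (0 : EuclideanSpace ℝ (Fin m)) 1).exists_isMinOn hne
    hcont.continuousOn
  have hu1 : ‖u‖ = 1 := by simpa using hu
  refine ⟨f u, ?_, fun x => ?_⟩
  · have : u.ofLp ≠ 0 := fun h => by
      have : u = 0 := by ext i; exact congrFun h i
      simp [this] at hu1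
    simpa using hA.dotProduct_mulVec_pos this
  · rcases eq_or_ne x 0 with rfl | hx
    · simp
    set y : EuclideanSpace ℝ (Fin m) := WithLp.toLp 2 x with hy
    have hy0 : y ≠ 0 := fun h => hx (by simpa [hy] using h)
    have hny : 0 < ‖y‖ := norm_pos_iff.2 hy0
    have hs : ‖y‖⁻¹ • y ∈ Metric.sphere (0 : EuclideanSpace ℝ (Fin m)) 1 := by
      simp [norm_smul, hny.ne']
    have h1 : f u ≤ f (‖y‖⁻¹ • y) := hmin hs
    have h2 : f (‖y‖⁻¹ • y) = ‖y‖⁻¹ ^ 2 * (x ⬝ᵥ A *ᵥ x) := by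
      simp only [hf, hy, WithLp.ofLp_smul, Matrix.mulVec_smul, dotProduct_smul, smul_dotProduct,
        smul_eq_mul]
      ring
    have h3 : x ⬝ᵥ x = ‖y‖ ^ 2 := by
      rw [EuclideanSpace.real_norm_sq_eq]
      simp [dotProduct, sq, hy]
    rw [h2] at h1
    rw [h3]
    calc f u * ‖y‖ ^ 2 ≤ ‖y‖⁻¹ ^ 2 * (x ⬝ᵥ A *ᵥ x) * ‖y‖ ^ 2 :=
          mul_le_mul_of_nonneg_right h1 (sq_nonneg _)
      _ = x ⬝ᵥ A *ᵥ x := by field_simp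

section Rho

variable {m M : ℕ} {G : SimpleGraph (Fin m)} {Gs : Fin M → SimpleGraph (Fin m)}
  {p : Fin M → unitInterval} {Cb : ℝ}

/-- Adding the projection onto the constants makes the expected Laplacian positive definite. -/
lemma meanLap_add_avgMatrix_posDef (hG : G.Connected) (hGs : ⨆ j, Gs j = G) (hCb : 0 < Cb)
    (hp : IsOptimalActivation Gs Cb p) : (meanLap Gs p + avgMatrix m).PosDef := by
  have hps : (meanLap Gs p).PosSemidef := weightedLap_posSemidef Gs fun j => (p j).2.1
  refine Matrix.PosDef.of_dotProduct_mulVec_pos ?_ fun x hx => ?_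
  · rw [Matrix.IsHermitian, Matrix.conjTranspose_eq_transpose_of_trivial, Matrix.transpose_add,
      avgMatrix_transpose, meanLap_eq, weightedLap_transpose]
  · have h1 := hps.dotProduct_mulVec_nonneg x
    have h2 := dotProduct_avgMatrix_nonneg x
    rw [star_trivial] at h1 ⊢
    rw [Matrix.add_mulVec, dotProduct_add]
    by_contra hneg
    have h3 : meanLap Gs p *ᵥ x = 0 := (hps.dotProduct_mulVec_zero_iff x).1 (by
      rw [star_trivial]; linarith)
    have h4 : x ⬝ᵥ avgMatrix m *ᵥ x = 0 := by linarith
    have hconst := hp.const_of_meanLap_mulVec_eq_zero hG hGs hCb h3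
    apply hx
    funext v
    have hm : (m : ℝ) ≠ 0 := Nat.cast_ne_zero.2 (by rintro rfl; exact v.elim0)
    have hsum : ∑ i, x i = m * x v := by
      rw [Finset.sum_congr rfl fun i _ => hconst i v]
      simp
    rw [dotProduct_avgMatrix, hsum] at h4
    simpa [hm] using h4

/-- All small positive weights satisfy the constraint of the semidefinite program with some
`r < 1`. -/
lemma exists_forall_sdpFeasible [NeZero m] (hG : G.Connected) (hGs : ⨆ j, Gs j = G) (hCb : 0 < Cb)
    (hp : IsOptimalActivation Gs Cb p) :
    ∃ α₀ : ℝ, 0 < α₀ ∧ ∀ α : ℝ, 0 < α → α < α₀ → ∃ r < 1, SDPFeasible Gs p r α (α ^ 2) := by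
  obtain ⟨c, hc, hcle⟩ :=
    exists_pos_le_dotProduct_mulVec (meanLap_add_avgMatrix_posDef hG hGs hCb hp)
  set Q := meanLap Gs p ^ 2 + (2 : ℝ) • varLap Gs p with hQ
  set C := ‖Matrix.toEuclideanCLM (n := Fin m) (𝕜 := ℝ) Q‖ with hC
  have hC0 : 0 ≤ C := norm_nonneg _
  refine ⟨min (1 / 2) (c / (C + 1)), lt_min (by norm_num) (by positivity), fun α hα hαlt => ?_⟩
  have hα2 : α ≤ 1 / 2 := hαlt.le.trans (min_le_left _ _)
  have hαC : α * C ≤ c := by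
    have := (lt_div_iff₀ (by positivity)).1 (hαlt.trans_le (min_le_right _ _))
    nlinarith
  refine ⟨1 - α * c, by nlinarith [mul_pos hα hc], by simp, ?_⟩
  refine Matrix.PosSemidef.of_dotProduct_mulVec_nonneg ?_ fun x => ?_
  · rw [Matrix.IsHermitian, Matrix.conjTranspose_eq_transpose_of_trivial]
    have hQT : Qᵀ = Q := by
      rw [← Matrix.conjTranspose_eq_transpose_of_trivial]
      exact meanLap_sq_add_varLap_posSemidef.isHermitian.eq
    have hLT : (meanLap Gs p)ᵀ = meanLap Gs p := weightedLap_transpose Gs _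
    rw [← hQ, Matrix.transpose_sub, Matrix.transpose_sub, Matrix.transpose_add,
      Matrix.transpose_sub, Matrix.transpose_smul, Matrix.transpose_smul, Matrix.transpose_smul,
      Matrix.transpose_one, avgMatrix_transpose, hQT, hLT]
  · have h1 := hcle x
    have h2 := dotProduct_mulVec_le_norm Q x
    have h3 := dotProduct_avgMatrix_nonneg x
    have hxx : 0 ≤ x ⬝ᵥ x := by
      simpa using dotProduct_star_self_nonneg x
    rw [Matrix.add_mulVec, dotProduct_add] at h1
    rw [← hQ]
    simp only [star_trivial, Matrix.sub_mulVec, Matrix.add_mulVec, Matrix.smul_mulVec,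
      dotProduct_sub, dotProduct_add, dotProduct_smul, smul_eq_mul, Matrix.one_mulVec]
    have h4 := mul_le_mul_of_nonneg_left h1 (by positivity : 0 ≤ 2 * α)
    have h5 := mul_le_mul_of_nonneg_left h2 (sq_nonneg α)
    have h6 := mul_le_mul_of_nonneg_right hαC (mul_nonneg hα.le hxx)
    have h7 := mul_nonneg (by linarith : 0 ≤ 1 - 2 * α) h3
    nlinarith

/-- The value `r` of a feasible point of the semidefinite program controls `ρ`, since replacing `β`
by `α²` only decreases the constrained matrix. -/
lemma rho_lt_one_of_sdpFeasible [NeZero m]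
    (hGs : ∀ j v w w', (Gs j).Adj v w → (Gs j).Adj v w' → w = w') {r α β : ℝ} (hr : r < 1)
    (h : SDPFeasible Gs p r α β) : rho Gs p α < 1 := by
  refine norm_toEuclideanCLM_lt_one hr (expectedGram_sub_avgMatrix_posSemidef hGs) ?_
  have h2 := h.2.add ((meanLap_sq_add_varLap_posSemidef (Gs := Gs) (p := p)).smul
    (by linarith [h.1] : 0 ≤ β - α ^ 2))
  rw [expectedGram_eq hGs]
  convert h2 using 1
  module

/-- `ρ < 1` for every small positive weight. -/
lemma exists_forall_rho_lt_one [NeZero m] (hG : G.Connected) (hGs : IsMatchingDecomposition G Gs)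
    (hCb : 0 < Cb) (hp : IsOptimalActivation Gs Cb p) :
    ∃ α₀ : ℝ, 0 < α₀ ∧ ∀ α : ℝ, 0 < α → α < α₀ → rho Gs p α < 1 := by
  obtain ⟨α₀, h0, h⟩ := exists_forall_sdpFeasible hG hGs.iSup_eq hCb hp
  refine ⟨α₀, h0, fun α hα hlt => ?_⟩
  obtain ⟨r, hr, hf⟩ := h α hα hlt
  exact rho_lt_one_of_sdpFeasible hGs.matching hr hf

/-- `ρ < 1` for a weight that solves the semidefinite program. -/
lemma IsOptimalWeight.rho_lt_one [NeZero m] (hG : G.Connected)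
    (hGs : IsMatchingDecomposition G Gs) (hCb : 0 < Cb) (hp : IsOptimalActivation Gs Cb p) {α : ℝ}
    (hα : IsOptimalWeight Gs p α) : rho Gs p α < 1 := by
  obtain ⟨α₀, h0, h⟩ := exists_forall_sdpFeasible hG hGs.iSup_eq hCb hp
  obtain ⟨r', hr', hf'⟩ := h (α₀ / 2) (by linarith) (by linarith)
  obtain ⟨r, β, hf, hmin⟩ := hα
  exact rho_lt_one_of_sdpFeasible hGs.matching ((hmin _ _ _ hf').trans_lt hr') hf

end Rho

/-! ### Conditional expectations of inner products -/

lemma CondIndepGiven.condExp_inter {Ω E : Type*} [MeasurableSpace E]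
    {𝓕 mΩ : MeasurableSpace Ω} {P : Measure Ω} [IsProbabilityMeasure P] {m : ℕ}
    {X : Fin m → Ω → E} (hX : CondIndepGiven P 𝓕 X) (h𝓕 : 𝓕 ≤ mΩ) {i j : Fin m} (hij : i ≠ j)
    {s t : Set E} (hs : MeasurableSet s) (ht : MeasurableSet t) :
    P⟦X i ⁻¹' s ∩ X j ⁻¹' t | 𝓕⟧ =ᵐ[P] P⟦X i ⁻¹' s | 𝓕⟧ * P⟦X j ⁻¹' t | 𝓕⟧ := by
  classical
  have h := hX (fun l => if l = i then s else if l = j then t else Set.univ) (by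
    intro l
    split_ifs
    exacts [hs, ht, MeasurableSet.univ])
  have hset : (⋂ l, X l ⁻¹' (if l = i then s else if l = j then t else Set.univ)) =
      X i ⁻¹' s ∩ X j ⁻¹' t := by
    ext ω
    simp only [Set.mem_iInter, Set.mem_preimage, Set.mem_inter_iff]
    constructor
    · intro hω
      have h1 := hω i
      have h2 := hω j
      simp only [if_true] at h1
      simp only [hij.symm, if_false, if_true] at h2
      exact ⟨h1, h2⟩
    · rintro ⟨h1, h2⟩ l
      split_ifs with e1 e2
      · exact e1 ▸ h1
      · exact e2 ▸ h2
      · trivial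
  rw [hset, Finset.prod_eq_mul i j hij (by
    intro l _ hl
    simp only [hl.1, hl.2, if_false, Set.preimage_univ, Set.indicator_univ]
    exact condExp_const h𝓕 (1 : ℝ)) (by simp) (by simp)] at h
  simpa [hij.symm] using h

section CondExp

variable {Ω E : Type*} [NormedAddCommGroup E] [InnerProductSpace ℝ E] {𝓕 mΩ : MeasurableSpace Ω}
  {P : Measure Ω}

lemma integrable_inner_of_memLp {f g : Ω → E} (hf : MemLp f 2 P) (hg : MemLp g 2 P) :
    Integrable (fun ω => inner ℝ (f ω) (g ω)) P := by
  refine ((hf.integrable_norm_pow (p := 2) two_ne_zero).add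
    (hg.integrable_norm_pow (p := 2) two_ne_zero)).mono'
    (hf.aestronglyMeasurable.inner hg.aestronglyMeasurable)
    (Filter.Eventually.of_forall fun ω => ?_)
  refine (norm_inner_le_norm (𝕜 := ℝ) (f ω) (g ω)).trans ?_
  simp only [Pi.add_apply]
  nlinarith [sq_nonneg (‖f ω‖ - ‖g ω‖), sq_nonneg (‖f ω‖), sq_nonneg (‖g ω‖)]

variable [CompleteSpace E] [IsProbabilityMeasure P]

lemma integral_inner_condExp (h𝓕 : 𝓕 ≤ mΩ) {f g : Ω → E} (hf𝓕 : StronglyMeasurable[𝓕] f)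
    (hf : MemLp f 2 P) (hg : MemLp g 2 P) :
    ∫ ω, inner ℝ (f ω) (g ω) ∂P = ∫ ω, inner ℝ (f ω) (P[g | 𝓕] ω) ∂P := by
  rw [← integral_condExp h𝓕]
  exact integral_congr_ae (condExp_bilin_of_stronglyMeasurable_left (innerSL ℝ) hf𝓕
    (integrable_inner_of_memLp hf hg) (hg.integrable one_le_two))

/-- The deviation of `g` from its conditional expectation is orthogonal to everything that is
measurable with respect to the σ-algebra. -/
lemma integral_inner_sub_condExp_eq_zero (h𝓕 : 𝓕 ≤ mΩ) {f g h : Ω → E}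
    (hf𝓕 : StronglyMeasurable[𝓕] f) (hf : MemLp f 2 P) (hg : MemLp g 2 P) (hh : MemLp h 2 P)
    (hgh : P[g | 𝓕] =ᵐ[P] h) : ∫ ω, inner ℝ (f ω) (g ω - h ω) ∂P = 0 := by
  simp only [inner_sub_right]
  rw [integral_sub (integrable_inner_of_memLp hf hg) (integrable_inner_of_memLp hf hh),
    integral_inner_condExp h𝓕 hf𝓕 hf hg, sub_eq_zero]
  refine integral_congr_ae ?_
  filter_upwards [hgh] with ω hω
  rw [hω]

/-- A function whose integral over every event `X ⁻¹' s` vanishes has conditional expectation zero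
given `X`. -/
lemma condExp_comap_eq_zero {β : Type*} [mβ : MeasurableSpace β] {X : Ω → β} (hX : Measurable X)
    {Z : Ω → E} (hZ : Integrable Z P)
    (h : ∀ s, MeasurableSet s → ∫ ω in X ⁻¹' s, Z ω ∂P = 0) :
    P[Z | mβ.comap X] =ᵐ[P] 0 := by
  symm
  refine ae_eq_condExp_of_forall_setIntegral_eq hX.comap_le hZ
    (fun s _ _ => integrableOn_zero) ?_ aestronglyMeasurable_zero
  rintro _ ⟨s, hs, rfl⟩ _
  rw [h s hs]
  simp

variable [MeasurableSpace E] [BorelSpace E] [SecondCountableTopology E]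

/-- Deviations of conditionally independent square-integrable vectors from their conditional
expectations are uncorrelated. Conditional independence is a statement about events; it is
transported to the vectors in two steps. For a fixed event `t` of `X j`, the variable
`1_t - P(t | 𝓕)` has conditional expectation zero given `X i`, hence `X i - E[X i | 𝓕]` integrates
to zero over `t`. As `t` is arbitrary, `X i - E[X i | 𝓕]` has conditional expectation zero given
`X j`. -/
lemma CondIndepGiven.integral_inner_sub_eq_zero {m : ℕ} {X : Fin m → Ω → E}
    (hX : CondIndepGiven P 𝓕 X) (h𝓕 : 𝓕 ≤ mΩ) (hXm : ∀ i, Measurable (X i))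
    (hX2 : ∀ i, MemLp (X i) 2 P) {H : Fin m → Ω → E} (hH𝓕 : ∀ i, StronglyMeasurable[𝓕] (H i))
    (hH2 : ∀ i, MemLp (H i) 2 P) (hXH : ∀ i, P[X i | 𝓕] =ᵐ[P] H i) {i j : Fin m} (hij : i ≠ j) :
    ∫ ω, inner ℝ (X i ω - H i ω) (X j ω - H j ω) ∂P = 0 := by
  have hXi : Integrable (X i) P := (hX2 i).integrable one_le_two
  have hHi : Integrable (H i) P := (hH2 i).integrable one_le_two
  have hZ2 : MemLp (fun ω => X i ω - H i ω) 2 P := (hX2 i).sub (hH2 i)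
  have hset : ∀ t, MeasurableSet t → ∫ ω in X j ⁻¹' t, (X i ω - H i ω) ∂P = 0 := by
    intro t ht
    have hmt : MeasurableSet (X j ⁻¹' t) := hXm j ht
    set I : Ω → ℝ := (X j ⁻¹' t).indicator fun _ => 1 with hI
    set c : Ω → ℝ := P[I | 𝓕] with hc
    have hIint : Integrable I P := (integrable_const 1).indicator hmt
    have hcint : Integrable c P := integrable_condExp
    have hcb : ∀ᵐ ω ∂P, |c ω| ≤ 1 := by
      refine ae_bdd_abs_condExp_of_ae_bdd_abs (Filter.Eventually.of_forall fun ω => ?_)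
      simp only [hI, Set.indicator]
      split_ifs <;> simp
    have hIb : ∀ ω, ‖I ω‖ ≤ 1 := by
      intro ω
      simp only [hI, Set.indicator]
      split_ifs <;> simp
    have hc𝓕 : StronglyMeasurable[𝓕] c := stronglyMeasurable_condExp
    have hcm : AEStronglyMeasurable c P := (hc𝓕.mono h𝓕).aestronglyMeasurable
    have hI_smul : ∀ {Y : Ω → E}, Integrable Y P → Integrable (I • Y) P := fun hY =>
      hY.bdd_smul 1 hIint.aestronglyMeasurable (Filter.Eventually.of_forall hIb)
    have hc_smul : ∀ {Y : Ω → E}, Integrable Y P → Integrable (c • Y) P := fun hY =>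
      hY.bdd_smul 1 hcm (by filter_upwards [hcb] with ω hω using by simpa using hω)
    -- `I - c` integrates to zero over every event of `X i`.
    have hT : ∀ s, MeasurableSet s → ∫ ω in X i ⁻¹' s, (I - c) ω ∂P = 0 := by
      intro s hs
      have hms : MeasurableSet (X i ⁻¹' s) := hXm i hs
      set J : Ω → ℝ := (X i ⁻¹' s).indicator fun _ => 1 with hJ
      have hJint : Integrable J P := (integrable_const 1).indicator hms
      have h1 : ∫ ω in X i ⁻¹' s, I ω ∂P = ∫ ω, (P[J | 𝓕] * c) ω ∂P := by
        rw [← integral_congr_ae (hX.condExp_inter h𝓕 hij hs ht), integral_condExp h𝓕,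
          ← integral_indicator hms, hI, Set.indicator_indicator]
      have hcJ : Integrable (J * c) P :=
        hcint.bdd_mul hJint.aestronglyMeasurable (c := 1) (Filter.Eventually.of_forall fun ω => by
          simp only [hJ, Set.indicator]
          split_ifs <;> simp)
      have h2 : ∫ ω in X i ⁻¹' s, c ω ∂P = ∫ ω, (P[J | 𝓕] * c) ω ∂P := by
        rw [← integral_congr_ae (condExp_mul_of_stronglyMeasurable_right hc𝓕 hcJ hJint),
          integral_condExp h𝓕, ← integral_indicator hms]
        congr 1
        funext ω
        simp only [hJ, Set.indicator, Pi.mul_apply]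
        split_ifs <;> simp
      simp only [Pi.sub_apply]
      rw [integral_sub hIint.integrableOn hcint.integrableOn, h1, h2, sub_self]
    have hT0 := condExp_comap_eq_zero (hXm i) (hIint.sub hcint) hT
    have hIc : ∫ ω, (I • X i) ω ∂P = ∫ ω, (c • X i) ω ∂P := by
      have h3 : ∫ ω, ((I - c) • X i) ω ∂P = 0 := by
        have hint : Integrable ((I - c) • X i) P := by
          rw [sub_smul]
          exact (hI_smul hXi).sub (hc_smul hXi)
        rw [← integral_condExp (hXm i).comap_le, integral_congr_ae
          (condExp_smul_of_aestronglyMeasurable_right (hIint.sub hcint) hint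
            (comap_measurable (X i)).stronglyMeasurable.aestronglyMeasurable)]
        refine integral_eq_zero_of_ae ?_
        filter_upwards [hT0] with ω hω
        simp [hω]
      rw [sub_smul] at h3
      have h4 := integral_sub (hI_smul hXi) (hc_smul hXi)
      simp only [Pi.sub_apply] at h3
      rw [h3] at h4
      exact (sub_eq_zero.1 h4.symm)
    have hcX : ∫ ω, (c • X i) ω ∂P = ∫ ω, (c • H i) ω ∂P := by
      rw [← integral_condExp h𝓕, integral_congr_ae (condExp_smul_of_aestronglyMeasurable_left
        hc𝓕.aestronglyMeasurable (hc_smul hXi) hXi)]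
      refine integral_congr_ae ?_
      filter_upwards [hXH i] with ω hω
      simp [hω]
    have hIH : ∫ ω, (I • H i) ω ∂P = ∫ ω, (c • H i) ω ∂P := by
      rw [← integral_condExp h𝓕, integral_congr_ae (condExp_smul_of_aestronglyMeasurable_right
        hIint (hI_smul hHi) (hH𝓕 i).aestronglyMeasurable)]
    have hind : ∀ Y : Ω → E, ∫ ω in X j ⁻¹' t, Y ω ∂P = ∫ ω, (I • Y) ω ∂P := by
      intro Y
      rw [← integral_indicator hmt]
      congr 1
      funext ω
      simp only [hI, Set.indicator, Pi.smul_apply']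
      split_ifs <;> simp
    rw [integral_sub hXi.integrableOn hHi.integrableOn, hind, hind, hIc, hcX, hIH, sub_self]
  have hZ0 := condExp_comap_eq_zero (hXm j) (hZ2.integrable one_le_two) hset
  simp only [inner_sub_right]
  rw [integral_sub (integrable_inner_of_memLp hZ2 (hX2 j)) (integrable_inner_of_memLp hZ2 (hH2 j))]
  have h1 : ∫ ω, inner ℝ (X i ω - H i ω) (X j ω) ∂P = 0 := by
    simp only [real_inner_comm (X j _)]
    rw [integral_inner_condExp (hXm j).comap_le (comap_measurable (X j)).stronglyMeasurable
      (hX2 j) hZ2]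
    refine integral_eq_zero_of_ae ?_
    filter_upwards [hZ0] with ω hω
    simp [hω]
  have h2 : ∫ ω, inner ℝ (X i ω - H i ω) (H j ω) ∂P = 0 := by
    simp only [real_inner_comm (H j _)]
    exact integral_inner_sub_condExp_eq_zero h𝓕 (hH𝓕 j) (hH2 j) (hX2 i) (hH2 i) (hXH i)
  rw [h1, h2, sub_zero]

end CondExp

/-! ### Averages and dispersion -/

section Dispersion

variable {m d : ℕ}

/-- The consensus error `∑ᵢ ‖yᵢ - ȳ‖²` of a family of vectors. -/
noncomputable def dispersion (y : Fin m → EuclideanSpace ℝ (Fin d)) : ℝ :=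
  ∑ i, ‖y i - average y‖ ^ 2

lemma dispersion_nonneg (y : Fin m → EuclideanSpace ℝ (Fin d)) : 0 ≤ dispersion y :=
  Finset.sum_nonneg fun _ _ => sq_nonneg _

lemma average_sub (y z : Fin m → EuclideanSpace ℝ (Fin d)) :
    average (fun i => y i - z i) = average y - average z := by
  simp only [average, Finset.sum_sub_distrib, smul_sub]

lemma average_smul (c : ℝ) (y : Fin m → EuclideanSpace ℝ (Fin d)) :
    average (fun i => c • y i) = c • average y := by
  simp only [average, ← Finset.smul_sum]
  rw [smul_comm]

/-- By the Cauchy-Schwarz inequality. -/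
lemma norm_average_sq_le (y : Fin m → EuclideanSpace ℝ (Fin d)) :
    ‖average y‖ ^ 2 ≤ (1 / (m : ℝ)) * ∑ i, ‖y i‖ ^ 2 := by
  have h1 : ‖average y‖ ≤ (1 / (m : ℝ)) * ∑ i, ‖y i‖ := by
    unfold average
    rw [norm_smul, Real.norm_of_nonneg (by positivity)]
    exact mul_le_mul_of_nonneg_left (norm_sum_le _ _) (by positivity)
  have h2 : (∑ i, ‖y i‖) ^ 2 ≤ m * ∑ i, ‖y i‖ ^ 2 := by
    simpa using sq_sum_le_card_mul_sum_sq (s := Finset.univ) (f := fun i => ‖y i‖)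
  rcases Nat.eq_zero_or_pos m with rfl | hm
  · simp [average]
  have hm' : (0 : ℝ) < m := Nat.cast_pos.2 hm
  calc ‖average y‖ ^ 2 ≤ ((1 / (m : ℝ)) * ∑ i, ‖y i‖) ^ 2 := by gcongr
    _ = (1 / (m : ℝ)) ^ 2 * (∑ i, ‖y i‖) ^ 2 := mul_pow _ _ _
    _ ≤ (1 / (m : ℝ)) ^ 2 * (m * ∑ i, ‖y i‖ ^ 2) := by gcongr
    _ = _ := by field_simp

lemma dispersion_smul (c : ℝ) (y : Fin m → EuclideanSpace ℝ (Fin d)) :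
    dispersion (fun i => c • y i) = c ^ 2 * dispersion y := by
  unfold dispersion
  rw [average_smul, Finset.mul_sum]
  refine Finset.sum_congr rfl fun i _ => ?_
  rw [← smul_sub, norm_smul, mul_pow, Real.norm_eq_abs, sq_abs]

/-- Young's inequality `s ‖u - v‖² ≤ ‖u‖² + s / (1 - s) ‖v‖²` for the dispersion. -/
lemma mul_dispersion_sub_le {s : ℝ} (hs0 : 0 ≤ s) (hs1 : s < 1)
    (y z : Fin m → EuclideanSpace ℝ (Fin d)) :
    s * dispersion (fun i => y i - z i) ≤ dispersion y + s / (1 - s) * dispersion z := by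
  have hs : 0 < 1 - s := sub_pos.2 hs1
  unfold dispersion
  rw [average_sub, Finset.mul_sum, Finset.mul_sum, ← Finset.sum_add_distrib]
  refine Finset.sum_le_sum fun i _ => ?_
  set u := y i - average y
  set v := z i - average z
  have huv : y i - z i - (average y - average z) = u - v := by
    simp only [u, v]; abel
  rw [huv, norm_sub_sq_real]
  -- The difference of the two sides is `‖(1 - s) u + s v‖² / (1 - s)`.
  have h := sq_nonneg ‖(1 - s) • u + s • v‖
  rw [norm_add_sq_real, norm_smul, norm_smul, inner_smul_left, inner_smul_right,
    Real.norm_of_nonneg hs.le, Real.norm_of_nonneg hs0] at h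
  simp only [conj_trivial] at h
  have h2 : ‖u‖ ^ 2 + s / (1 - s) * ‖v‖ ^ 2 - s * (‖u‖ ^ 2 - 2 * inner ℝ u v + ‖v‖ ^ 2) =
      (((1 - s) * ‖u‖) ^ 2 + 2 * ((1 - s) * (s * inner ℝ u v)) + (s * ‖v‖) ^ 2) / (1 - s) := by
    field_simp
    ring
  have h3 := div_nonneg h hs.le
  linarith

variable [NeZero m]

lemma average_const (c : EuclideanSpace ℝ (Fin d)) : average (fun _ : Fin m => c) = c := by
  have hm : (m : ℝ) ≠ 0 := Nat.cast_ne_zero.2 (NeZero.ne m)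
  simp only [average, Finset.sum_const, Finset.card_univ, Fintype.card_fin]
  rw [← Nat.cast_smul_eq_nsmul ℝ, smul_smul, one_div_mul_cancel hm, one_smul]

lemma sum_eq_smul_average (y : Fin m → EuclideanSpace ℝ (Fin d)) :
    ∑ i, y i = (m : ℝ) • average y := by
  have hm : (m : ℝ) ≠ 0 := Nat.cast_ne_zero.2 (NeZero.ne m)
  unfold average
  rw [smul_smul, mul_one_div_cancel hm, one_smul]

lemma sum_sub_average (y : Fin m → EuclideanSpace ℝ (Fin d)) : ∑ i, (y i - average y) = 0 := by
  rw [Finset.sum_sub_distrib, sum_eq_smul_average y]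
  simp only [Finset.sum_const, Finset.card_univ, Fintype.card_fin]
  rw [← Nat.cast_smul_eq_nsmul ℝ, sub_self]

lemma sum_inner_sub_average (y z : Fin m → EuclideanSpace ℝ (Fin d)) :
    ∑ i, inner ℝ (y i - average y) (z i - average z) = ∑ i, inner ℝ (y i - average y) (z i) := by
  simp only [inner_sub_right]
  rw [Finset.sum_sub_distrib, ← sum_inner, sum_sub_average, inner_zero_left, sub_zero]

lemma dispersion_le_sum_norm_sq (y : Fin m → EuclideanSpace ℝ (Fin d)) :
    dispersion y ≤ ∑ i, ‖y i‖ ^ 2 := by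
  have h : ∑ i, ‖y i‖ ^ 2 = dispersion y + m * ‖average y‖ ^ 2 := by
    have h1 : ∀ i, ‖y i‖ ^ 2 = ‖y i - average y‖ ^ 2 + 2 * inner ℝ (y i - average y) (average y) +
        ‖average y‖ ^ 2 := by
      intro i
      rw [← norm_add_sq_real, sub_add_cancel]
    simp only [h1]
    rw [Finset.sum_add_distrib, Finset.sum_add_distrib, ← Finset.mul_sum, ← sum_inner,
      sum_sub_average, inner_zero_left, dispersion]
    simp
  rw [h]
  have : (0 : ℝ) ≤ m * ‖average y‖ ^ 2 := by positivity
  linarith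

/-- Expansion of the dispersion of a difference. -/
lemma dispersion_sub (y z : Fin m → EuclideanSpace ℝ (Fin d)) :
    dispersion (fun i => y i - z i) =
      dispersion y - 2 * ∑ i, inner ℝ (y i - average y) (z i) + dispersion z := by
  rw [← sum_inner_sub_average]
  unfold dispersion
  rw [average_sub, Finset.mul_sum, ← Finset.sum_sub_distrib, ← Finset.sum_add_distrib]
  refine Finset.sum_congr rfl fun i _ => ?_
  rw [← norm_sub_sq_real, sub_sub_sub_comm]

end Dispersion

/-! ### Mixing contracts the dispersion -/

section Mixing

variable {m M d : ℕ}

/-- A real quadratic form evaluated on vectors is bounded by the operator norm, coordinate by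
coordinate. -/
lemma sum_mul_inner_le (A : Matrix (Fin m) (Fin m) ℝ) (z : Fin m → EuclideanSpace ℝ (Fin d)) :
    ∑ j, ∑ l, A j l * inner ℝ (z j) (z l) ≤
      ‖Matrix.toEuclideanCLM (n := Fin m) (𝕜 := ℝ) A‖ * ∑ j, ‖z j‖ ^ 2 := by
  have h1 : ∑ j, ∑ l, A j l * inner ℝ (z j) (z l) =
      ∑ c, (fun j => z j c) ⬝ᵥ A *ᵥ (fun j => z j c) := by
    simp only [PiLp.inner_apply, RCLike.inner_apply, conj_trivial, dotProduct, Matrix.mulVec,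
      Finset.mul_sum]
    symm
    rw [Finset.sum_comm]
    refine Finset.sum_congr rfl fun j _ => ?_
    rw [Finset.sum_comm]
    refine Finset.sum_congr rfl fun l _ => Finset.sum_congr rfl fun c _ => ?_
    ring
  have h2 : ∑ j, ‖z j‖ ^ 2 = ∑ c, (fun j => z j c) ⬝ᵥ (fun j => z j c) := by
    simp only [EuclideanSpace.real_norm_sq_eq, dotProduct]
    rw [Finset.sum_comm]
    simp only [sq]
  rw [h1, h2, Finset.mul_sum]
  exact Finset.sum_le_sum fun c _ => dotProduct_mulVec_le_norm A _

variable {Gs : Fin M → SimpleGraph (Fin m)} {p : Fin M → unitInterval} {α : ℝ}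

lemma sum_mixingMatrix_row (b : Fin M → Bool) (i : Fin m) : ∑ j, mixingMatrix Gs α b i j = 1 := by
  have h : mixingMatrix Gs α b *ᵥ (fun _ => 1) = fun _ => 1 := by
    rw [mixingMatrix_eq, Matrix.sub_mulVec, Matrix.one_mulVec, Matrix.smul_mulVec,
      weightedLap_mulVec_one, smul_zero, sub_zero]
  simpa [Matrix.mulVec, dotProduct] using congrFun h i

lemma sum_mixingMatrix_col (b : Fin M → Bool) (j : Fin m) : ∑ i, mixingMatrix Gs α b i j = 1 := by
  rw [← sum_mixingMatrix_row (Gs := Gs) (α := α) b j]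
  refine Finset.sum_congr rfl fun i _ => ?_
  conv_lhs => rw [← mixingMatrix_transpose]
  rfl

lemma average_mixing (b : Fin M → Bool) (y : Fin m → EuclideanSpace ℝ (Fin d)) :
    average (fun i => ∑ j, mixingMatrix Gs α b i j • y j) = average y := by
  unfold average
  rw [Finset.sum_comm]
  simp only [← Finset.sum_smul, sum_mixingMatrix_col, one_smul]

lemma dispersion_mixing (b : Fin M → Bool) (y : Fin m → EuclideanSpace ℝ (Fin d)) :
    dispersion (fun i => ∑ j, mixingMatrix Gs α b i j • y j) =
      ∑ j, ∑ l, ((mixingMatrix Gs α b)ᵀ * mixingMatrix Gs α b) j l *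
        inner ℝ (y j - average y) (y l - average y) := by
  unfold dispersion
  rw [average_mixing]
  have h : ∀ i, ∑ j, mixingMatrix Gs α b i j • y j - average y =
      ∑ j, mixingMatrix Gs α b i j • (y j - average y) := by
    intro i
    simp only [smul_sub, Finset.sum_sub_distrib, ← Finset.sum_smul, sum_mixingMatrix_row, one_smul]
  have hsq : ∀ i, ‖∑ j, mixingMatrix Gs α b i j • (y j - average y)‖ ^ 2 = ∑ j, ∑ l,
      mixingMatrix Gs α b i j * mixingMatrix Gs α b i l *
        inner ℝ (y j - average y) (y l - average y) := by
    intro i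
    rw [← real_inner_self_eq_norm_sq, sum_inner]
    refine Finset.sum_congr rfl fun j _ => ?_
    rw [inner_sum]
    refine Finset.sum_congr rfl fun l _ => ?_
    rw [inner_smul_left, inner_smul_right, conj_trivial, mul_assoc]
  simp only [h, hsq, Matrix.mul_apply, Matrix.transpose_apply, Finset.sum_mul]
  rw [Finset.sum_comm]
  refine Finset.sum_congr rfl fun j _ => ?_
  rw [Finset.sum_comm]

/-- The expected quadratic form does not exceed `ρ` times the dispersion; `𝟏𝟏ᵀ/m` may be subtracted
because it annihilates centered families. -/
lemma sum_expectedGram_mul_inner_le [NeZero m] (y : Fin m → EuclideanSpace ℝ (Fin d)) :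
    ∑ j, ∑ l, expectedGram Gs p α j l * inner ℝ (y j - average y) (y l - average y) ≤
      rho Gs p α * dispersion y := by
  have h := sum_mul_inner_le (expectedGram Gs p α - avgMatrix m) fun j => y j - average y
  refine le_trans (le_of_eq ?_) h
  simp only [Matrix.sub_apply, sub_mul, Finset.sum_sub_distrib, avgMatrix, Matrix.of_apply]
  simp only [← Finset.mul_sum, ← inner_sum, sum_sub_average, inner_zero_right]
  simp

end Mixing

/-! ### Functions with Lipschitz gradient -/

section Smooth

variable {d : ℕ}

/-- The descent lemma: `f y ≤ f x + ⟨∇f x, y - x⟩ + L/2 ‖y - x‖²`. -/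
lemma le_add_inner_gradient_add {f : EuclideanSpace ℝ (Fin d) → ℝ} (hf : Differentiable ℝ f) {L : ℝ}
    (hL : ∀ y z, ‖gradient f y - gradient f z‖ ≤ L * ‖y - z‖) (x v : EuclideanSpace ℝ (Fin d)) :
    f (x + v) ≤ f x + inner ℝ (gradient f x) v + L / 2 * ‖v‖ ^ 2 := by
  -- The gap of the claimed inequality along the segment from `x` to `x + v` is monotone.
  set φ : ℝ → ℝ := fun t => f (x + t • v) - t * inner ℝ (gradient f x) v - L / 2 * ‖v‖ ^ 2 * t ^ 2
    with hφ
  have hder : ∀ t, HasDerivAt φ (inner ℝ (gradient f (x + t • v)) v - inner ℝ (gradient f x) v -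
      L / 2 * ‖v‖ ^ 2 * (2 * t)) t := by
    intro t
    have h1 : HasDerivAt (fun t : ℝ => x + t • v) v t := by
      simpa using ((hasDerivAt_id t).smul_const v).const_add x
    have h2 := (hf (x + t • v)).hasFDerivAt.comp_hasDerivAt t h1
    rw [← inner_gradient_left] at h2
    have h3 := (h2.sub ((hasDerivAt_id t).mul_const (inner ℝ (gradient f x) v))).sub
      ((hasDerivAt_pow 2 t).const_mul (L / 2 * ‖v‖ ^ 2))
    refine HasDerivAt.congr_deriv (f := φ) h3 ?_
    simp
  have hanti : AntitoneOn φ (Set.Icc 0 1) := by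
    refine antitoneOn_of_deriv_nonpos (convex_Icc 0 1)
      (fun t _ => (hder t).continuousAt.continuousWithinAt)
      (fun t _ => (hder t).differentiableAt.differentiableWithinAt) fun t ht => ?_
    rw [interior_Icc] at ht
    rw [(hder t).deriv, ← inner_sub_left]
    have h1 := (real_inner_le_norm (gradient f (x + t • v) - gradient f x) v)
    have h2 := hL (x + t • v) x
    rw [add_sub_cancel_left, norm_smul, Real.norm_of_nonneg ht.1.le] at h2
    have h3 := mul_le_mul_of_nonneg_right h2 (norm_nonneg v)
    nlinarith
  have h := hanti (Set.left_mem_Icc.2 zero_le_one) (Set.right_mem_Icc.2 zero_le_one) zero_le_one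
  simp only [hφ, one_smul, zero_smul, add_zero] at h
  linarith

variable {m : ℕ} {F : Fin m → EuclideanSpace ℝ (Fin d) → ℝ}

lemma differentiable_globalObj (hF : ∀ i, Differentiable ℝ (F i)) :
    Differentiable ℝ (globalObj F) := by
  unfold globalObj
  fun_prop

lemma gradient_globalObj (hF : ∀ i, Differentiable ℝ (F i)) (x : EuclideanSpace ℝ (Fin d)) :
    gradient (globalObj F) x = average fun i => gradient (F i) x := by
  refine HasGradientAt.gradient ?_
  rw [hasGradientAt_iff_hasFDerivAt]
  have h := (HasFDerivAt.fun_sum (u := Finset.univ) fun i _ =>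
    ((hF i x).hasGradientAt.hasFDerivAt)).const_mul (1 / (m : ℝ))
  refine HasFDerivAt.congr_fderiv (f := globalObj F) h ?_
  simp only [average, map_smul, map_sum]

lemma norm_gradient_globalObj_sub_le [NeZero m] (hF : ∀ i, Differentiable ℝ (F i)) {L : ℝ}
    (hL : ∀ i y z, ‖gradient (F i) y - gradient (F i) z‖ ≤ L * ‖y - z‖)
    (y z : EuclideanSpace ℝ (Fin d)) :
    ‖gradient (globalObj F) y - gradient (globalObj F) z‖ ≤ L * ‖y - z‖ := by
  have hm : (m : ℝ) ≠ 0 := Nat.cast_ne_zero.2 (NeZero.ne m)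
  rw [gradient_globalObj hF, gradient_globalObj hF, ← average_sub]
  unfold average
  rw [norm_smul, Real.norm_of_nonneg (by positivity)]
  calc (1 / (m : ℝ)) * ‖∑ i, (gradient (F i) y - gradient (F i) z)‖
      ≤ (1 / (m : ℝ)) * ∑ _i : Fin m, L * ‖y - z‖ := by
        gcongr
        exact (norm_sum_le _ _).trans (Finset.sum_le_sum fun i _ => hL i y z)
    _ = L * ‖y - z‖ := by
        simp only [Finset.sum_const, Finset.card_univ, Fintype.card_fin, nsmul_eq_mul]
        field_simp

lemma norm_gradient_globalObj_sub_average_sq_le (hF : ∀ i, Differentiable ℝ (F i)) {L : ℝ}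
    (hL : ∀ i y z, ‖gradient (F i) y - gradient (F i) z‖ ≤ L * ‖y - z‖)
    (x : Fin m → EuclideanSpace ℝ (Fin d)) :
    ‖gradient (globalObj F) (average x) - average (fun i => gradient (F i) (x i))‖ ^ 2 ≤
      L ^ 2 / m * dispersion x := by
  rw [gradient_globalObj hF, ← average_sub]
  refine (norm_average_sq_le _).trans ?_
  have h : ∑ i, ‖gradient (F i) (average x) - gradient (F i) (x i)‖ ^ 2 ≤ L ^ 2 * dispersion x := by
    unfold dispersion
    rw [Finset.mul_sum]
    refine Finset.sum_le_sum fun i _ => ?_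
    rw [← mul_pow, norm_sub_rev (x i)]
    exact pow_le_pow_left₀ (norm_nonneg _) (hL i _ _) 2
  calc _ ≤ (1 / (m : ℝ)) * (L ^ 2 * dispersion x) := by gcongr
    _ = _ := by ring

/-- The local gradients are controlled by the consensus error, the gradient dissimilarity and the
gradient of the global objective at the average. -/
lemma sum_norm_gradient_sq_le [NeZero m] {L ζ : ℝ}
    (hL : ∀ i y z, ‖gradient (F i) y - gradient (F i) z‖ ≤ L * ‖y - z‖)
    (hζ : ∀ y, (1 / (m : ℝ)) * ∑ i, ‖gradient (F i) y - gradient (globalObj F) y‖ ^ 2 ≤ ζ ^ 2)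
    (x : Fin m → EuclideanSpace ℝ (Fin d)) :
    ∑ i, ‖gradient (F i) (x i)‖ ^ 2 ≤
      3 * L ^ 2 * dispersion x + 3 * m * ζ ^ 2 +
        3 * m * ‖gradient (globalObj F) (average x)‖ ^ 2 := by
  have hm : (0 : ℝ) < m := Nat.cast_pos.2 (NeZero.pos m)
  set g := gradient (globalObj F) (average x) with hg
  have h1 : ∀ i, ‖gradient (F i) (x i)‖ ^ 2 ≤ 3 * (L ^ 2 * ‖x i - average x‖ ^ 2) +
      3 * ‖gradient (F i) (average x) - g‖ ^ 2 + 3 * ‖g‖ ^ 2 := by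
    intro i
    set a := gradient (F i) (x i) - gradient (F i) (average x)
    set b := gradient (F i) (average x) - g
    have hsum : gradient (F i) (x i) = a + b + g := by simp only [a, b]; abel
    have ha : ‖a‖ ^ 2 ≤ L ^ 2 * ‖x i - average x‖ ^ 2 := by
      rw [← mul_pow]
      exact pow_le_pow_left₀ (norm_nonneg _) (hL i _ _) 2
    have hn : ‖a + b + g‖ ≤ ‖a‖ + ‖b‖ + ‖g‖ := norm_add₃_le
    have hn2 := pow_le_pow_left₀ (norm_nonneg _) hn 2
    rw [hsum]
    nlinarith [sq_nonneg (‖a‖ - ‖b‖), sq_nonneg (‖a‖ - ‖g‖), sq_nonneg (‖b‖ - ‖g‖)]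
  have h2 : ∑ i, ‖gradient (F i) (average x) - g‖ ^ 2 ≤ m * ζ ^ 2 := by
    have := mul_le_mul_of_nonneg_left (hζ (average x)) hm.le
    rwa [← mul_assoc, mul_one_div_cancel hm.ne', one_mul] at this
  have h3 := Finset.sum_le_sum fun i (_ : i ∈ Finset.univ) => h1 i
  rw [Finset.sum_add_distrib, Finset.sum_add_distrib, ← Finset.mul_sum, ← Finset.mul_sum,
    ← Finset.mul_sum, Finset.sum_const, Finset.card_univ, Fintype.card_fin, nsmul_eq_mul] at h3
  unfold dispersion
  linarith

end Smooth

/-! ### One iteration of decentralized SGD -/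

section Step

variable {m M d : ℕ} {Ω : Type*} {𝓕 𝓖 mΩ : MeasurableSpace Ω} {P : Measure Ω}

/-- `G` is a family of square-integrable estimators of the `𝓕`-measurable family `H` whose errors
are orthogonal to the past `𝓕`, uncorrelated between workers, and of variance at most `σ²`. -/
structure IsNoisyVersion (P : Measure Ω) (𝓕 : MeasurableSpace Ω)
    (G H : Fin m → Ω → EuclideanSpace ℝ (Fin d)) (σ : ℝ) : Prop where
  stronglyMeasurable : ∀ i, StronglyMeasurable[𝓕] (H i)
  memLp_mean : ∀ i, MemLp (H i) 2 P
  memLp : ∀ i, MemLp (G i) 2 P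
  orthogonal : ∀ i f, StronglyMeasurable[𝓕] f → MemLp f 2 P →
    ∫ ω, inner ℝ (f ω) (G i ω - H i ω) ∂P = 0
  uncorrelated : ∀ i j, i ≠ j → ∫ ω, inner ℝ (G i ω - H i ω) (G j ω - H j ω) ∂P = 0
  variance : ∀ i, ∫ ω, ‖G i ω - H i ω‖ ^ 2 ∂P ≤ σ ^ 2

lemma memLp_average {X : Fin m → Ω → EuclideanSpace ℝ (Fin d)} (hX : ∀ i, MemLp (X i) 2 P) :
    MemLp (fun ω => average fun i => X i ω) 2 P :=
  (memLp_finsetSum _ fun i _ => hX i).const_smul (1 / (m : ℝ))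

lemma stronglyMeasurable_average {X : Fin m → Ω → EuclideanSpace ℝ (Fin d)}
    (hX : ∀ i, StronglyMeasurable[𝓕] (X i)) :
    StronglyMeasurable[𝓕] fun ω => average fun i => X i ω :=
  (Finset.stronglyMeasurable_fun_sum Finset.univ fun i _ => hX i).const_smul (1 / (m : ℝ))

lemma integrable_dispersion {X : Fin m → Ω → EuclideanSpace ℝ (Fin d)}
    (hX : ∀ i, MemLp (X i) 2 P) : Integrable (fun ω => dispersion fun i => X i ω) P := by
  unfold dispersion
  exact integrable_finsetSum _ fun i _ =>
    ((hX i).sub (memLp_average hX)).integrable_norm_pow two_ne_zero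

lemma continuous_of_norm_sub_le {E : Type*} [NormedAddCommGroup E] {f : E → E} {L : ℝ}
    (hL0 : 0 ≤ L) (hL : ∀ y z, ‖f y - f z‖ ≤ L * ‖y - z‖) : Continuous f :=
  (LipschitzWith.of_dist_le_mul (K := ⟨L, hL0⟩) fun y z => by
    rw [dist_eq_norm, dist_eq_norm]; exact hL y z).continuous

/-- A Lipschitz map grows at most linearly, so it preserves square integrability. -/
lemma memLp_comp_of_norm_sub_le [IsProbabilityMeasure P]
    {f : EuclideanSpace ℝ (Fin d) → EuclideanSpace ℝ (Fin d)} {L : ℝ}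
    (hL0 : 0 ≤ L) (hL : ∀ y z, ‖f y - f z‖ ≤ L * ‖y - z‖)
    {X : Ω → EuclideanSpace ℝ (Fin d)} (hX : MemLp X 2 P) :
    MemLp (fun ω => f (X ω)) 2 P := by
  have h0 : MemLp (fun _ : Ω => ‖f 0‖) 2 P := memLp_const _
  have h1 : MemLp (fun ω => L * ‖X ω‖) 2 P := hX.norm.const_mul L
  have hb : MemLp (fun ω => ‖f 0‖ + L * ‖X ω‖) 2 P := h0.add h1
  refine hb.of_le ((continuous_of_norm_sub_le hL0 hL).comp_aestronglyMeasurable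
    hX.aestronglyMeasurable) (Filter.Eventually.of_forall fun ω => ?_)
  have h1 := hL (X ω) 0
  rw [sub_zero] at h1
  have h2 : ‖f (X ω)‖ ≤ ‖f 0‖ + ‖f (X ω) - f 0‖ := norm_le_norm_add_norm_sub' _ _
  rw [Real.norm_of_nonneg (add_nonneg (norm_nonneg _) (mul_nonneg hL0 (norm_nonneg _)))]
  linarith

/-- A function with Lipschitz gradient that is bounded below has at most quadratic growth. -/
lemma integrable_comp_of_memLp [IsProbabilityMeasure P] {f : EuclideanSpace ℝ (Fin d) → ℝ}
    (hf : Differentiable ℝ f) {L c : ℝ}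
    (hL : ∀ y z, ‖gradient f y - gradient f z‖ ≤ L * ‖y - z‖) (hc : ∀ y, c ≤ f y)
    {X : Ω → EuclideanSpace ℝ (Fin d)} (hX : MemLp X 2 P) : Integrable (fun ω => f (X ω)) P := by
  have hup : Integrable (fun ω => f 0 + inner ℝ (gradient f 0) (X ω) + L / 2 * ‖X ω‖ ^ 2) P :=
    ((integrable_const _).add (integrable_inner_of_memLp (memLp_const _) hX)).add
      ((hX.integrable_norm_pow two_ne_zero).const_mul _)
  refine integrable_of_le_of_le
    (hf.continuous.comp_aestronglyMeasurable hX.aestronglyMeasurable)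
    (Filter.Eventually.of_forall fun ω => hc (X ω)) (Filter.Eventually.of_forall fun ω => ?_)
    (integrable_const c) hup
  simpa using le_add_inner_gradient_add hf hL 0 (X ω)

variable {X G H : Fin m → Ω → EuclideanSpace ℝ (Fin d)} {σ η : ℝ}

lemma IsNoisyVersion.memLp_noise (h : IsNoisyVersion P 𝓕 G H σ) (i : Fin m) :
    MemLp (fun ω => G i ω - H i ω) 2 P :=
  (h.memLp i).sub (h.memLp_mean i)

lemma IsNoisyVersion.integral_inner_average (h : IsNoisyVersion P 𝓕 G H σ)
    {f : Ω → EuclideanSpace ℝ (Fin d)} (hf𝓕 : StronglyMeasurable[𝓕] f) (hf : MemLp f 2 P) :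
    ∫ ω, inner ℝ (f ω) (average fun i => G i ω - H i ω) ∂P = 0 := by
  simp only [average, inner_smul_right, inner_sum]
  rw [integral_const_mul, integral_finsetSum _ fun i _ =>
    integrable_inner_of_memLp hf (h.memLp_noise i)]
  simp [h.orthogonal _ f hf𝓕 hf]

/-- Averaging over the workers reduces the variance by the factor `m`. -/
lemma IsNoisyVersion.integral_norm_average_sq_le (h : IsNoisyVersion P 𝓕 G H σ) :
    ∫ ω, ‖average fun i => G i ω - H i ω‖ ^ 2 ∂P ≤ σ ^ 2 / m := by
  have hint : ∀ i j, Integrable (fun ω => inner ℝ (G i ω - H i ω) (G j ω - H j ω)) P :=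
    fun i j => integrable_inner_of_memLp (h.memLp_noise i) (h.memLp_noise j)
  have hexp : ∀ ω, ‖average fun i => G i ω - H i ω‖ ^ 2 =
      (1 / (m : ℝ)) ^ 2 * ∑ i, ∑ j, inner ℝ (G i ω - H i ω) (G j ω - H j ω) := by
    intro ω
    unfold average
    rw [norm_smul, mul_pow, Real.norm_of_nonneg (by positivity), ← real_inner_self_eq_norm_sq,
      sum_inner]
    simp only [inner_sum]
  simp only [hexp]
  rw [integral_const_mul,
    integral_finsetSum _ fun i _ => integrable_finsetSum _ fun j _ => hint i j]
  have hrow : ∀ i, ∫ ω, ∑ j, inner ℝ (G i ω - H i ω) (G j ω - H j ω) ∂P ≤ σ ^ 2 := by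
    intro i
    rw [integral_finsetSum _ fun j _ => hint i j,
      Finset.sum_eq_single i (fun j _ hj => h.uncorrelated i j hj.symm) (by simp)]
    simpa only [real_inner_self_eq_norm_sq] using h.variance i
  calc _ ≤ (1 / (m : ℝ)) ^ 2 * ∑ _i : Fin m, σ ^ 2 := by
        gcongr with i
        exact hrow i
    _ = σ ^ 2 / m := by
        rw [Finset.sum_const, Finset.card_univ, Fintype.card_fin, nsmul_eq_mul]
        rcases eq_or_ne (m : ℝ) 0 with hm | hm
        · simp [hm]
        · field_simp

/-- Noise that is orthogonal to the past adds to the dispersion. -/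
lemma IsNoisyVersion.integral_dispersion_le [NeZero m] (h : IsNoisyVersion P 𝓕 G H σ)
    (hX𝓕 : ∀ i, StronglyMeasurable[𝓕] (X i)) (hX : ∀ i, MemLp (X i) 2 P) :
    ∫ ω, dispersion (fun i => X i ω - η • G i ω) ∂P ≤
      ∫ ω, dispersion (fun i => X i ω - η • H i ω) ∂P + η ^ 2 * (m * σ ^ 2) := by
  set Y : Fin m → Ω → EuclideanSpace ℝ (Fin d) := fun i ω => X i ω - η • H i ω with hY
  have hY2 : ∀ i, MemLp (Y i) 2 P := fun i => (hX i).sub ((h.memLp_mean i).const_smul η)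
  have hY𝓕 : ∀ i, StronglyMeasurable[𝓕] (Y i) := fun i =>
    (hX𝓕 i).sub ((h.stronglyMeasurable i).const_smul η)
  have hc𝓕 : ∀ i, StronglyMeasurable[𝓕] fun ω => Y i ω - average fun i => Y i ω := fun i =>
    (hY𝓕 i).sub (stronglyMeasurable_average hY𝓕)
  have hc2 : ∀ i, MemLp (fun ω => Y i ω - average fun i => Y i ω) 2 P := fun i =>
    (hY2 i).sub (memLp_average hY2)
  have hsplit : ∀ ω, dispersion (fun i => X i ω - η • G i ω) =
      dispersion (fun i => Y i ω) -
        2 * η * ∑ i, inner ℝ (Y i ω - average fun i => Y i ω) (G i ω - H i ω) +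
        η ^ 2 * dispersion (fun i => G i ω - H i ω) := by
    intro ω
    have h1 : (fun i => X i ω - η • G i ω) = fun i => Y i ω - η • (G i ω - H i ω) := by
      funext i
      simp only [hY, smul_sub]
      abel
    rw [h1, dispersion_sub (fun i => Y i ω) fun i => η • (G i ω - H i ω), dispersion_smul]
    simp only [inner_smul_right]
    rw [← Finset.mul_sum]
    ring
  have hi : ∀ i, Integrable
      (fun ω => inner ℝ (Y i ω - average fun i => Y i ω) (G i ω - H i ω)) P := fun i =>
    integrable_inner_of_memLp (hc2 i) (h.memLp_noise i)
  have hdN : Integrable (fun ω => dispersion fun i => G i ω - H i ω) P :=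
    integrable_dispersion h.memLp_noise
  have hnoise : ∫ ω, dispersion (fun i => G i ω - H i ω) ∂P ≤ m * σ ^ 2 := by
    calc _ ≤ ∫ ω, ∑ i, ‖G i ω - H i ω‖ ^ 2 ∂P :=
          integral_mono hdN (integrable_finsetSum _ fun i _ =>
            (h.memLp_noise i).integrable_norm_pow two_ne_zero) fun ω => dispersion_le_sum_norm_sq _
      _ = ∑ i, ∫ ω, ‖G i ω - H i ω‖ ^ 2 ∂P := integral_finsetSum _ fun i _ =>
            (h.memLp_noise i).integrable_norm_pow two_ne_zero
      _ ≤ ∑ _i : Fin m, σ ^ 2 := Finset.sum_le_sum fun i _ => h.variance i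
      _ = m * σ ^ 2 := by simp
  have hD := integrable_dispersion hY2
  have hS := (integrable_finsetSum Finset.univ fun i _ => hi i).const_mul (2 * η)
  have e1 := integral_add (hD.sub hS) (hdN.const_mul (η ^ 2))
  have e2 := integral_sub hD hS
  simp only [Pi.sub_apply] at e1
  simp only [hsplit]
  rw [e1, e2, integral_const_mul, integral_const_mul, integral_finsetSum _ fun i _ => hi i,
    Finset.sum_eq_zero fun i _ => h.orthogonal i _ (hc𝓕 i) (hc2 i)]
  have := mul_le_mul_of_nonneg_left hnoise (sq_nonneg η)
  linarith

/-- Random mixing that is independent of the models contracts the expected dispersion by `ρ`. -/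
lemma integral_dispersion_mixing_le [IsProbabilityMeasure P] [NeZero m]
    {Gs : Fin M → SimpleGraph (Fin m)}
    {p : Fin M → unitInterval} {α : ℝ} {B : Ω → Fin M → Bool} (hB : Measurable B)
    (hlaw : HasLaw B (activationLaw p) P)
    (hind : Indep (MeasurableSpace.comap B inferInstance) 𝓕 P)
    (hX𝓕 : ∀ i, StronglyMeasurable[𝓕] (X i)) (hX : ∀ i, MemLp (X i) 2 P) :
    ∫ ω, dispersion (fun i => ∑ j, mixingMatrix Gs α (B ω) i j • X j ω) ∂P ≤
      rho Gs p α * ∫ ω, dispersion (fun i => X i ω) ∂P := by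
  set q : Fin m → Fin m → Ω → ℝ := fun j l ω =>
    inner ℝ (X j ω - average fun i => X i ω) (X l ω - average fun i => X i ω) with hq
  set w : Fin m → Fin m → (Fin M → Bool) → ℝ := fun j l b =>
    ((mixingMatrix Gs α b)ᵀ * mixingMatrix Gs α b) j l with hw
  have hq𝓕 : ∀ j l, StronglyMeasurable[𝓕] (q j l) := fun j l =>
    ((hX𝓕 j).sub (stronglyMeasurable_average hX𝓕)).inner
      ((hX𝓕 l).sub (stronglyMeasurable_average hX𝓕))
  have hqi : ∀ j l, Integrable (q j l) P := fun j l =>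
    integrable_inner_of_memLp ((hX j).sub (memLp_average hX)) ((hX l).sub (memLp_average hX))
  have hwm : ∀ j l, Measurable (w j l) := fun j l => measurable_of_finite _
  have hwB : ∀ j l, Measurable[MeasurableSpace.comap B inferInstance] fun ω => w j l (B ω) :=
    fun j l => (hwm j l).comp (comap_measurable B)
  have hIF : ∀ j l, IndepFun (fun ω => w j l (B ω)) (q j l) P := by
    intro j l
    rw [IndepFun_iff_Indep]
    exact indep_of_indep_of_le_right (indep_of_indep_of_le_left hind (hwB j l).comap_le)
      (hq𝓕 j l).measurable.comap_le
  have hwint : ∀ j l, Integrable (fun ω => w j l (B ω)) P := by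
    intro j l
    have h1 : Integrable (w j l) (P.map B) := by
      rw [hlaw.map_eq]
      exact integrable_activationLaw p _
    exact h1.comp_measurable hB
  have hprod : ∀ j l, Integrable (fun ω => w j l (B ω) * q j l ω) P := fun j l =>
    (hIF j l).integrable_mul (hwint j l) (hqi j l)
  have hE : ∀ j l, ∫ ω, w j l (B ω) * q j l ω ∂P =
      ∫ ω, expectedGram Gs p α j l * q j l ω ∂P := by
    intro j l
    rw [(hIF j l).integral_fun_mul_eq_mul_integral (hwint j l).aestronglyMeasurable
      (hqi j l).aestronglyMeasurable, integral_const_mul]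
    congr 1
    exact hlaw.integral_comp (hwm j l).aestronglyMeasurable
  simp only [dispersion_mixing]
  change ∫ ω, ∑ j, ∑ l, w j l (B ω) * q j l ω ∂P ≤ _
  rw [integral_finsetSum _ fun j _ => integrable_finsetSum _ fun l _ => hprod j l]
  simp only [integral_finsetSum _ fun l _ => hprod _ l, hE]
  have hprod' : ∀ j l, Integrable (fun ω => expectedGram Gs p α j l * q j l ω) P := fun j l =>
    (hqi j l).const_mul _
  simp only [← integral_finsetSum _ fun l _ => hprod' _ l]
  rw [← integral_finsetSum _ fun j _ => integrable_finsetSum _ fun l _ => hprod' j l,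
    ← integral_const_mul]
  exact integral_mono
    (integrable_finsetSum _ fun j _ => integrable_finsetSum _ fun l _ => hprod' j l)
    ((integrable_dispersion hX).const_mul _) fun ω => sum_expectedGram_mul_inner_le _

variable [IsProbabilityMeasure P] [NeZero m] {F : Fin m → EuclideanSpace ℝ (Fin d) → ℝ} {L ζ c : ℝ}

/-- Expected descent of the global objective along the averaged model. -/
lemma IsNoisyVersion.integral_globalObj_le
    (h : IsNoisyVersion P 𝓕 G (fun i ω => gradient (F i) (X i ω)) σ)
    (hX𝓕 : ∀ i, StronglyMeasurable[𝓕] (X i)) (hX : ∀ i, MemLp (X i) 2 P)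
    (hF : ∀ i, Differentiable ℝ (F i)) (hL0 : 0 ≤ L)
    (hL : ∀ i y z, ‖gradient (F i) y - gradient (F i) z‖ ≤ L * ‖y - z‖)
    (hc : ∀ y, c ≤ globalObj F y) (hη : 0 < η) (hηL : η * L ≤ 1) :
    ∫ ω, globalObj F (average fun i => X i ω - η • G i ω) ∂P ≤
      ∫ ω, globalObj F (average fun i => X i ω) ∂P -
        η / 2 * ∫ ω, ‖gradient (globalObj F) (average fun i => X i ω)‖ ^ 2 ∂P +
        η / 2 * (L ^ 2 / m) * ∫ ω, dispersion (fun i => X i ω) ∂P +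
        L * η ^ 2 / 2 * (σ ^ 2 / m) := by
  have hF' := differentiable_globalObj hF
  have hL' := norm_gradient_globalObj_sub_le hF hL
  set a : Ω → EuclideanSpace ℝ (Fin d) := fun ω =>
    gradient (globalObj F) (average fun i => X i ω) with ha
  set b : Ω → EuclideanSpace ℝ (Fin d) := fun ω => average fun i => gradient (F i) (X i ω) with hb
  set N : Ω → EuclideanSpace ℝ (Fin d) := fun ω =>
    average fun i => G i ω - gradient (F i) (X i ω) with hN
  have ha2 : MemLp a 2 P := memLp_comp_of_norm_sub_le hL0 hL' (memLp_average hX)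
  have hb2 : MemLp b 2 P := memLp_average h.memLp_mean
  have hN2 : MemLp N 2 P := memLp_average h.memLp_noise
  have ha𝓕 : StronglyMeasurable[𝓕] a :=
    (continuous_of_norm_sub_le hL0 hL').comp_stronglyMeasurable
      (stronglyMeasurable_average hX𝓕)
  have hb𝓕 : StronglyMeasurable[𝓕] b := stronglyMeasurable_average h.stronglyMeasurable
  -- Polarization of `-η ⟨a, b⟩` produces `-η/2 ‖b‖²`, which absorbs `L η²/2 ‖b‖²` as `η L ≤ 1`.
  have hpt : ∀ ω, globalObj F (average fun i => X i ω - η • G i ω) ≤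
      globalObj F (average fun i => X i ω) - η / 2 * ‖a ω‖ ^ 2 +
        η / 2 * (L ^ 2 / m) * dispersion (fun i => X i ω) - η * inner ℝ (a ω) (N ω) +
        L * η ^ 2 * inner ℝ (b ω) (N ω) + L * η ^ 2 / 2 * ‖N ω‖ ^ 2 := by
    intro ω
    have hg : (average fun i => G i ω) = b ω + N ω := by
      simp only [hN, average_sub]
      simp only [hb]
      abel
    have h1 := le_add_inner_gradient_add hF' hL' (average fun i => X i ω) (-(η • (b ω + N ω)))
    rw [← sub_eq_add_neg, ← hg, ← average_smul, ← average_sub, average_smul, hg, norm_neg,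
      norm_smul, mul_pow, Real.norm_eq_abs, sq_abs, inner_neg_right, inner_smul_right,
      inner_add_right, norm_add_sq_real] at h1
    have h2 : ‖a ω - b ω‖ ^ 2 ≤ L ^ 2 / m * dispersion (fun i => X i ω) :=
      norm_gradient_globalObj_sub_average_sq_le hF hL _
    rw [norm_sub_sq_real] at h2
    have h3 := mul_le_mul_of_nonneg_left h2 (by positivity : 0 ≤ η / 2)
    have h4 : η * (η * L) * ‖b ω‖ ^ 2 ≤ η * 1 * ‖b ω‖ ^ 2 := by gcongr
    simp only [ha] at h1 h3 ⊢
    linarith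
  have i0 : Integrable (fun ω => globalObj F (average fun i => X i ω)) P :=
    integrable_comp_of_memLp hF' hL' hc (memLp_average hX)
  have i1 : Integrable (fun ω => η / 2 * ‖a ω‖ ^ 2) P :=
    (ha2.integrable_norm_pow two_ne_zero).const_mul _
  have i2 : Integrable (fun ω => η / 2 * (L ^ 2 / m) * dispersion (fun i => X i ω)) P :=
    (integrable_dispersion hX).const_mul _
  have i3 : Integrable (fun ω => η * inner ℝ (a ω) (N ω)) P :=
    (integrable_inner_of_memLp ha2 hN2).const_mul _
  have i4 : Integrable (fun ω => L * η ^ 2 * inner ℝ (b ω) (N ω)) P :=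
    (integrable_inner_of_memLp hb2 hN2).const_mul _
  have i5 : Integrable (fun ω => L * η ^ 2 / 2 * ‖N ω‖ ^ 2) P :=
    (hN2.integrable_norm_pow two_ne_zero).const_mul _
  have hleft : Integrable (fun ω => globalObj F (average fun i => X i ω - η • G i ω)) P :=
    integrable_comp_of_memLp hF' hL' hc
      (memLp_average fun i => (hX i).sub ((h.memLp i).const_smul η))
  have hmono := integral_mono hleft (((((i0.sub i1).add i2).sub i3).add i4).add i5) hpt
  have e5 := integral_add ((((i0.sub i1).add i2).sub i3).add i4) i5
  have e4 := integral_add (((i0.sub i1).add i2).sub i3) i4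
  have e3 := integral_sub ((i0.sub i1).add i2) i3
  have e2 := integral_add (i0.sub i1) i2
  have e1 := integral_sub i0 i1
  have z3 : ∫ ω, η * inner ℝ (a ω) (N ω) ∂P = 0 := by
    rw [integral_const_mul, h.integral_inner_average ha𝓕 ha2, mul_zero]
  have z4 : ∫ ω, L * η ^ 2 * inner ℝ (b ω) (N ω) ∂P = 0 := by
    rw [integral_const_mul, h.integral_inner_average hb𝓕 hb2, mul_zero]
  have z5 : ∫ ω, L * η ^ 2 / 2 * ‖N ω‖ ^ 2 ∂P ≤ L * η ^ 2 / 2 * (σ ^ 2 / m) := by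
    rw [integral_const_mul]
    exact mul_le_mul_of_nonneg_left h.integral_norm_average_sq_le (by positivity)
  simp only [Pi.add_apply, Pi.sub_apply] at hmono e5 e4 e3 e2 e1
  rw [e5, e4, e3, e2, e1, z3, z4, integral_const_mul, integral_const_mul] at hmono
  linarith

/-- Evolution of the expected consensus error under a gradient step followed by mixing. Young's
inequality spends a factor `√ρ` of the contraction `ρ` on separating the models from the
gradients. -/
lemma IsNoisyVersion.integral_dispersion_mixing_le {Gs : Fin M → SimpleGraph (Fin m)}
    {p : Fin M → unitInterval} {α : ℝ}
    (h : IsNoisyVersion P 𝓕 G (fun i ω => gradient (F i) (X i ω)) σ)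
    (hX𝓕 : ∀ i, StronglyMeasurable[𝓕] (X i)) (hX : ∀ i, MemLp (X i) 2 P)
    (hL : ∀ i y z, ‖gradient (F i) y - gradient (F i) z‖ ≤ L * ‖y - z‖)
    (hζ : ∀ y, (1 / (m : ℝ)) * ∑ i, ‖gradient (F i) y - gradient (globalObj F) y‖ ^ 2 ≤ ζ ^ 2)
    (hT : Integrable (fun ω => ‖gradient (globalObj F) (average fun i => X i ω)‖ ^ 2) P)
    (hρ : rho Gs p α < 1)
    (hXG : ∀ i, StronglyMeasurable[𝓖] (X i))
    (hGG : ∀ i, StronglyMeasurable[𝓖] (G i)) {B : Ω → Fin M → Bool} (hB : Measurable B)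
    (hlaw : HasLaw B (activationLaw p) P)
    (hind : Indep (MeasurableSpace.comap B inferInstance) 𝓖 P) :
    ∫ ω, dispersion (fun i => ∑ j, mixingMatrix Gs α (B ω) i j • (X j ω - η • G j ω)) ∂P ≤
      √(rho Gs p α) * ∫ ω, dispersion (fun i => X i ω) ∂P +
      rho Gs p α / (1 - √(rho Gs p α)) * η ^ 2 * (3 * L ^ 2 * ∫ ω, dispersion (fun i => X i ω) ∂P +
        3 * m * ζ ^ 2 +
        3 * m * ∫ ω, ‖gradient (globalObj F) (average fun i => X i ω)‖ ^ 2 ∂P) +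
      rho Gs p α * (η ^ 2 * (m * σ ^ 2)) := by
  have hρ0 : 0 ≤ rho Gs p α := norm_nonneg _
  set s := √(rho Gs p α) with hs
  have hs0 : 0 ≤ s := Real.sqrt_nonneg _
  have hs1 : s < 1 := by
    rw [hs, Real.sqrt_lt' one_pos]
    simpa using hρ
  have hρs : rho Gs p α = s * s := (Real.mul_self_sqrt hρ0).symm
  have h1 := Matcha.integral_dispersion_mixing_le (Gs := Gs) (α := α) hB hlaw hind
    (X := fun i ω => X i ω - η • G i ω) (fun i => (hXG i).sub ((hGG i).const_smul η))
    (fun i => (hX i).sub ((h.memLp i).const_smul η))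
  have h2 := h.integral_dispersion_le (η := η) hX𝓕 hX
  have hD := integrable_dispersion hX
  have h3 : s * ∫ ω, dispersion (fun i => X i ω - η • gradient (F i) (X i ω)) ∂P ≤
      ∫ ω, dispersion (fun i => X i ω) ∂P + s / (1 - s) * (η ^ 2 *
        (3 * L ^ 2 * ∫ ω, dispersion (fun i => X i ω) ∂P + 3 * m * ζ ^ 2 +
          3 * m * ∫ ω, ‖gradient (globalObj F) (average fun i => X i ω)‖ ^ 2 ∂P)) := by
    have hs' : 0 < 1 - s := sub_pos.2 hs1
    set κ := s / (1 - s) * η ^ 2 with hκ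
    have hκ0 : 0 ≤ κ := by positivity
    set δ : Ω → ℝ := fun ω => dispersion fun i => X i ω with hδ
    set τ : Ω → ℝ := fun ω => ‖gradient (globalObj F) (average fun i => X i ω)‖ ^ 2 with hτ
    have hpt : ∀ ω, s * dispersion (fun i => X i ω - η • gradient (F i) (X i ω)) ≤
        δ ω + κ * (3 * L ^ 2 * δ ω + 3 * m * ζ ^ 2 + 3 * m * τ ω) := by
      intro ω
      have k1 := mul_dispersion_sub_le hs0 hs1 (fun i => X i ω)
        (fun i => η • gradient (F i) (X i ω))
      have k2 := (dispersion_le_sum_norm_sq fun i => gradient (F i) (X i ω)).trans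
        (sum_norm_gradient_sq_le hL hζ fun i => X i ω)
      rw [dispersion_smul, ← mul_assoc] at k1
      have k3 := mul_le_mul_of_nonneg_left k2 hκ0
      exact k1.trans (by linarith)
    have j0 : Integrable (fun ω => 3 * L ^ 2 * δ ω) P := hD.const_mul _
    have j1 : Integrable (fun _ => 3 * m * ζ ^ 2) P := integrable_const _
    have j2 : Integrable (fun ω => 3 * m * τ ω) P := hT.const_mul _
    have j01 : Integrable (fun ω => 3 * L ^ 2 * δ ω + 3 * m * ζ ^ 2) P := j0.add j1
    have j3 : Integrable (fun ω => κ * (3 * L ^ 2 * δ ω + 3 * m * ζ ^ 2 + 3 * m * τ ω)) P :=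
      (j01.add j2).const_mul κ
    have hint : ∫ ω, (δ ω + κ * (3 * L ^ 2 * δ ω + 3 * m * ζ ^ 2 + 3 * m * τ ω)) ∂P =
        ∫ ω, δ ω ∂P + κ * (3 * L ^ 2 * ∫ ω, δ ω ∂P + 3 * m * ζ ^ 2 + 3 * m * ∫ ω, τ ω ∂P) := by
      rw [integral_add hD j3, integral_const_mul,
        integral_add j01 j2, integral_add j0 j1, integral_const_mul (3 * L ^ 2) δ,
        integral_const_mul (3 * (m : ℝ)) τ, integral_const, probReal_univ, one_smul]
    have hmono := integral_mono ((integrable_dispersion fun i =>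
      (hX i).sub ((h.memLp_mean i).const_smul η)).const_mul s)
      (hD.add j3) hpt
    rw [← mul_assoc]
    refine le_trans (le_of_eq ?_) (hmono.trans hint.le)
    exact (integral_const_mul _ _).symm
  have h4 := mul_le_mul_of_nonneg_left h3 hs0
  have h5 := mul_le_mul_of_nonneg_left h2 hρ0
  have h6 : s * (s / (1 - s)) = rho Gs p α / (1 - s) := by rw [hρs]; ring
  have h7 := h1.trans h5
  rw [mul_add, ← mul_assoc, ← hρs, mul_add, ← mul_assoc s, h6] at h4
  linarith

end Step

/-! ### Summing the one-step estimates -/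

/-- The step-size condition bounds `D` by `3 / 8`. -/
lemma stepSize_lt_half {s η L : ℝ} (hs0 : 0 ≤ s) (hs1 : s < 1) (hη : 0 < η) (hL : 0 ≤ L)
    (h : s ≠ 0 → η * L ≤ (s⁻¹ - 1) / 4) :
    6 * η ^ 2 * L ^ 2 * s ^ 2 / (1 - s) ^ 2 < 1 / 2 := by
  have hs : 0 < 1 - s := sub_pos.2 hs1
  have h1 : η * L * s ≤ (1 - s) / 4 := by
    rcases eq_or_ne s 0 with rfl | hs'
    · simp
    · have := mul_le_mul_of_nonneg_right (h hs') hs0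
      rw [div_mul_eq_mul_div, sub_mul, inv_mul_cancel₀ hs', one_mul] at this
      exact this
  have h2 := pow_le_pow_left₀ (by positivity) h1 2
  rw [div_lt_iff₀ (by positivity)]
  nlinarith [pow_pos hs 2]

/-- The bound on the averaged squared gradients `T k`, from the descent inequality for the objective
values `f k` and the recursion for the consensus errors `Y k`, both summed over `k < K`. -/
lemma average_le_of_recursion {m K : ℕ} (hm : 0 < m) (hK : 1 ≤ K) {Y T f : ℕ → ℝ}
    {s η L σ ζ Finf : ℝ} (hs0 : 0 ≤ s) (hs1 : s < 1) (hη : 0 < η) (hL : 0 ≤ L)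
    (hD : 6 * η ^ 2 * L ^ 2 * s ^ 2 / (1 - s) ^ 2 < 1 / 2)
    (hY0 : Y 0 = 0) (hY : ∀ k, 0 ≤ Y k) (hf0 : Finf ≤ f 0) (hfK : Finf ≤ f K)
    (hf : ∀ k < K, f (k + 1) ≤ f k - η / 2 * T k + η / 2 * (L ^ 2 / m) * Y k +
      L * η ^ 2 / 2 * (σ ^ 2 / m))
    (hrec : ∀ k < K, Y (k + 1) ≤ s * Y k + s ^ 2 / (1 - s) * η ^ 2 *
      (3 * L ^ 2 * Y k + 3 * m * ζ ^ 2 + 3 * m * T k) + s ^ 2 * (η ^ 2 * (m * σ ^ 2))) :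
    (1 / (K : ℝ)) * ∑ k ∈ Finset.range K, T k ≤
      (2 * (f 0 - Finf) / (η * K) + η * L * σ ^ 2 / m) *
        (1 / (1 - 2 * (6 * η ^ 2 * L ^ 2 * s ^ 2 / (1 - s) ^ 2))) +
      2 * η ^ 2 * L ^ 2 * s ^ 2 / (1 - s) * (σ ^ 2 / (1 + s) + 3 * ζ ^ 2 / (1 - s)) *
        (1 / (1 - 2 * (6 * η ^ 2 * L ^ 2 * s ^ 2 / (1 - s) ^ 2))) := by
  have hs : 0 < 1 - s := sub_pos.2 hs1
  have hs' : 0 < 1 + s := by linarith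
  have hm' : (0 : ℝ) < m := Nat.cast_pos.2 hm
  have hK' : (0 : ℝ) < K := Nat.cast_pos.2 hK
  set D := 6 * η ^ 2 * L ^ 2 * s ^ 2 / (1 - s) ^ 2 with hDdef
  set A := 2 * (f 0 - Finf) / (η * K) + η * L * σ ^ 2 / m with hA
  set ST := ∑ k ∈ Finset.range K, T k with hST
  set SY := ∑ k ∈ Finset.range K, Y k with hSY
  have hD0 : 0 ≤ D := by positivity
  have hA0 : 0 ≤ A := by
    have : 0 ≤ f 0 - Finf := sub_nonneg.2 hf0
    positivity
  have hSY0 : 0 ≤ SY := Finset.sum_nonneg fun k _ => hY k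
  -- The descent inequality, summed; the objective values telescope.
  have h1 : (1 / (K : ℝ)) * ST ≤ A + L ^ 2 * (SY / (m * K)) := by
    have hsum := Finset.sum_le_sum fun k (hk : k ∈ Finset.range K) => hf k (Finset.mem_range.1 hk)
    have htel := Finset.sum_range_sub f K
    rw [Finset.sum_sub_distrib] at htel
    rw [Finset.sum_add_distrib, Finset.sum_add_distrib, Finset.sum_sub_distrib, ← Finset.mul_sum,
      ← Finset.mul_sum, Finset.sum_const, Finset.card_range, nsmul_eq_mul] at hsum
    have h2 : η / 2 * ST ≤ f 0 - Finf + η / 2 * (L ^ 2 / m) * SY +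
        K * (L * η ^ 2 / 2 * (σ ^ 2 / m)) := by linarith
    have h3 := mul_le_mul_of_nonneg_left h2 (by positivity : 0 ≤ 2 / (η * K))
    calc (1 / (K : ℝ)) * ST = 2 / (η * K) * (η / 2 * ST) := by field_simp
      _ ≤ _ := h3
      _ = A + L ^ 2 * (SY / (m * K)) := by rw [hA]; field_simp; ring
  -- The recursion, summed: since `Y 0 = 0`, shifting the index leaves the sum of the errors on the
  -- left, and a fraction `s` of it is absorbed from the right.
  have h2 : SY / (m * K) ≤ s ^ 2 / (1 - s) ^ 2 * η ^ 2 *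
      (3 * L ^ 2 * (SY / (m * K)) + 3 * ζ ^ 2 + 3 * ((1 / (K : ℝ)) * ST)) +
      s ^ 2 / (1 - s) * η ^ 2 * σ ^ 2 := by
    have hsum := Finset.sum_le_sum fun k (hk : k ∈ Finset.range K) => hrec k (Finset.mem_range.1 hk)
    have hshift : ∑ k ∈ Finset.range K, Y (k + 1) = SY + Y K - Y 0 := by
      have := Finset.sum_range_succ Y K
      rw [Finset.sum_range_succ'] at this
      linarith
    rw [Finset.sum_add_distrib, Finset.sum_add_distrib, ← Finset.mul_sum, ← Finset.mul_sum,
      Finset.sum_add_distrib, Finset.sum_add_distrib, ← Finset.mul_sum _ Y (3 * L ^ 2),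
      ← Finset.mul_sum _ T (3 * (m : ℝ)), Finset.sum_const, Finset.sum_const, Finset.card_range,
      nsmul_eq_mul, nsmul_eq_mul, hshift, hY0] at hsum
    have h3 : (1 - s) * SY ≤ s ^ 2 / (1 - s) * η ^ 2 *
        (3 * L ^ 2 * SY + K * (3 * m * ζ ^ 2) + 3 * m * ST) +
        K * (s ^ 2 * (η ^ 2 * (m * σ ^ 2))) := by linarith [hY K]
    have h4 := mul_le_mul_of_nonneg_left h3 (by positivity : 0 ≤ 1 / ((1 - s) * (m * K)))
    calc SY / (m * K) = 1 / ((1 - s) * (m * K)) * ((1 - s) * SY) := by field_simp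
      _ ≤ _ := h4
      _ = _ := by field_simp
  set Tb := (1 / (K : ℝ)) * ST with hTb
  set u := L ^ 2 * (SY / (m * K)) with hu
  set C := 2 * η ^ 2 * L ^ 2 * s ^ 2 / (1 - s) * (σ ^ 2 / (1 + s) + 3 * ζ ^ 2 / (1 - s)) with hC
  have hC0 : 0 ≤ C := by positivity
  have hu0 : 0 ≤ u := by positivity
  have h3 : u ≤ D / 2 * u + C + D / 2 * Tb := by
    have h4 := mul_le_mul_of_nonneg_left h2 (sq_nonneg L)
    have h5 : L ^ 2 * (s ^ 2 / (1 - s) ^ 2 * η ^ 2 *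
        (3 * L ^ 2 * (SY / (m * K)) + 3 * ζ ^ 2 + 3 * Tb) + s ^ 2 / (1 - s) * η ^ 2 * σ ^ 2) =
        D / 2 * u + D / 2 * Tb + (3 * L ^ 2 * s ^ 2 * η ^ 2 * ζ ^ 2 / (1 - s) ^ 2 +
          L ^ 2 * s ^ 2 * η ^ 2 * σ ^ 2 / (1 - s)) := by
      rw [hDdef, hu]
      field_simp
      ring
    have h6 : C - (3 * L ^ 2 * s ^ 2 * η ^ 2 * ζ ^ 2 / (1 - s) ^ 2 +
        L ^ 2 * s ^ 2 * η ^ 2 * σ ^ 2 / (1 - s)) =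
        3 * L ^ 2 * s ^ 2 * η ^ 2 * ζ ^ 2 / (1 - s) ^ 2 +
          L ^ 2 * s ^ 2 * η ^ 2 * σ ^ 2 / (1 + s) := by
      rw [hC]
      field_simp
      ring
    have h7 : 0 ≤ 3 * L ^ 2 * s ^ 2 * η ^ 2 * ζ ^ 2 / (1 - s) ^ 2 +
        L ^ 2 * s ^ 2 * η ^ 2 * σ ^ 2 / (1 + s) := by positivity
    linarith
  have h4 : Tb * (1 - D) ≤ A * (1 - D / 2) + C := by
    have := mul_le_mul_of_nonneg_right h1 (by linarith : 0 ≤ 1 - D / 2)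
    linarith
  have h5 : Tb * (1 - 2 * D) ≤ A + C := by
    rcases le_or_gt Tb 0 with hT | hT
    · have := mul_nonneg (neg_nonneg.2 hT) (by linarith : 0 ≤ 1 - 2 * D)
      linarith
    · nlinarith [mul_nonneg hT.le hD0, mul_nonneg hA0 hD0]
  rw [← add_mul, mul_one_div, le_div_iff₀ (by linarith)]
  exact h5

/-! ### The iterates -/

section Iterates

variable {m M d : ℕ} {Ω Ξ : Type*} [MeasurableSpace Ξ]

lemma history_mono (ξ : ℕ → Fin m → Ω → Ξ) (B : ℕ → Ω → Fin M → Bool) {k l : ℕ} (h : k ≤ l) :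
    history ξ B k ≤ history ξ B l :=
  biSup_mono fun _ hi => Finset.mem_range.2 ((Finset.mem_range.1 hi).trans_le h)

lemma comap_sample_le_historyWithSamples (ξ : ℕ → Fin m → Ω → Ξ) (B : ℕ → Ω → Fin M → Bool)
    (k : ℕ) (i : Fin m) :
    MeasurableSpace.comap (ξ k i) inferInstance ≤ historyWithSamples ξ B k :=
  le_sup_of_le_right (le_iSup (fun i => MeasurableSpace.comap (ξ k i) inferInstance) i)

lemma current_le_history_succ (ξ : ℕ → Fin m → Ω → Ξ) (B : ℕ → Ω → Fin M → Bool) (k : ℕ) :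
    (⨆ i, MeasurableSpace.comap (ξ k i) inferInstance) ⊔
      MeasurableSpace.comap (B k) inferInstance ≤ history ξ B (k + 1) :=
  le_biSup (fun l => (⨆ i, MeasurableSpace.comap (ξ l i) inferInstance) ⊔
    MeasurableSpace.comap (B l) inferInstance) (Finset.mem_range.2 k.lt_succ_self)

lemma historyWithSamples_le_history_succ (ξ : ℕ → Fin m → Ω → Ξ) (B : ℕ → Ω → Fin M → Bool)
    (k : ℕ) : historyWithSamples ξ B k ≤ history ξ B (k + 1) :=
  sup_le (history_mono ξ B k.le_succ) (le_sup_left.trans (current_le_history_succ ξ B k))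

lemma history_le {mΩ : MeasurableSpace Ω} {ξ : ℕ → Fin m → Ω → Ξ} {B : ℕ → Ω → Fin M → Bool}
    {k : ℕ} (hξ : ∀ l < k, ∀ i, Measurable (ξ l i)) (hB : ∀ l < k, Measurable (B l)) :
    history ξ B k ≤ mΩ :=
  iSup₂_le fun l hl => sup_le (iSup_le fun i => (hξ l (Finset.mem_range.1 hl) i).comap_le)
    (hB l (Finset.mem_range.1 hl)).comap_le

lemma measurable_gradientSample {_ : MeasurableSpace Ω}
    {g : EuclideanSpace ℝ (Fin d) → Ξ → EuclideanSpace ℝ (Fin d)}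
    (hg : Measurable (Function.uncurry g)) {x : Ω → EuclideanSpace ℝ (Fin d)} (hx : Measurable x)
    {z : Ω → Ξ} (hz : Measurable z) : Measurable fun ω => g (x ω) (z ω) :=
  hg.comp (hx.prodMk hz)

lemma measurable_mixing {_ : MeasurableSpace Ω} {Gs : Fin M → SimpleGraph (Fin m)} {α : ℝ}
    {B : Ω → Fin M → Bool} (hB : Measurable B) {y : Fin m → Ω → EuclideanSpace ℝ (Fin d)}
    (hy : ∀ i, Measurable (y i)) (i : Fin m) :
    Measurable fun ω => ∑ j, mixingMatrix Gs α (B ω) i j • y j ω :=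
  Finset.measurable_fun_sum _ fun j _ =>
    ((measurable_of_finite fun b => mixingMatrix Gs α b i j).comp hB).smul (hy j)

/-- Mixing preserves square integrability, since there are finitely many mixing matrices. -/
lemma memLp_mixing {mΩ : MeasurableSpace Ω} {P : Measure Ω} {Gs : Fin M → SimpleGraph (Fin m)}
    {α : ℝ} {B : Ω → Fin M → Bool} (hB : Measurable B) {y : Fin m → Ω → EuclideanSpace ℝ (Fin d)}
    (hy : ∀ i, MemLp (y i) 2 P) (i : Fin m) :
    MemLp (fun ω => ∑ j, mixingMatrix Gs α (B ω) i j • y j ω) 2 P := by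
  refine memLp_finsetSum _ fun j _ => ?_
  refine (hy j).of_le_mul (c := ∑ b : Fin M → Bool, |mixingMatrix Gs α b i j|)
    (((measurable_of_finite fun b => mixingMatrix Gs α b i j).comp hB).aestronglyMeasurable.smul
      (hy j).aestronglyMeasurable) (Filter.Eventually.of_forall fun ω => ?_)
  rw [norm_smul]
  gcongr
  exact Finset.single_le_sum (f := fun b => |mixingMatrix Gs α b i j|) (fun b _ => abs_nonneg _)
    (Finset.mem_univ (B ω))

variable {Gs : Fin M → SimpleGraph (Fin m)} {α η : ℝ} {x₁ : EuclideanSpace ℝ (Fin d)}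
  {g : Fin m → EuclideanSpace ℝ (Fin d) → Ξ → EuclideanSpace ℝ (Fin d)}
  {ξ : ℕ → Fin m → Ω → Ξ} {B : ℕ → Ω → Fin M → Bool}

lemma measurable_gradientSample_iterate (hg : ∀ i, Measurable (Function.uncurry (g i))) {k : ℕ}
    (hx : ∀ i, Measurable[history ξ B k]
      (iterate g η x₁ (fun k ω => mixingMatrix Gs α (B k ω)) ξ k i)) (i : Fin m) :
    Measurable[historyWithSamples ξ B k] fun ω =>
      g i (iterate g η x₁ (fun k ω => mixingMatrix Gs α (B k ω)) ξ k i ω) (ξ k i ω) :=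
  measurable_gradientSample (hg i) ((hx i).mono le_sup_left le_rfl)
    ((comap_measurable (ξ k i)).mono (comap_sample_le_historyWithSamples ξ B k i) le_rfl)

/-- The models are determined by the history. -/
lemma measurable_iterate (hg : ∀ i, Measurable (Function.uncurry (g i))) (k : ℕ) (i : Fin m) :
    Measurable[history ξ B k] (iterate g η x₁ (fun k ω => mixingMatrix Gs α (B k ω)) ξ k i) := by
  induction k generalizing i with
  | zero => exact measurable_const
  | succ k ih =>
    have hle := historyWithSamples_le_history_succ ξ B k
    refine measurable_mixing (y := fun j ω =>
      iterate g η x₁ (fun k ω => mixingMatrix Gs α (B k ω)) ξ k j ω -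
        η • g j (iterate g η x₁ (fun k ω => mixingMatrix Gs α (B k ω)) ξ k j ω) (ξ k j ω))
      ((comap_measurable (B k)).mono
        (le_sup_right.trans (current_le_history_succ ξ B k)) le_rfl) (fun j => ?_) i
    exact ((ih j).mono (history_mono ξ B k.le_succ) le_rfl).sub
      (((measurable_gradientSample_iterate hg ih j).mono hle le_rfl).const_smul η)

end Iterates

/-! ### Convergence of decentralized SGD -/

/-- The standing assumptions on the gradient oracle turn the stochastic gradients of an iteration
into a noisy version of the local gradients. -/
lemma isNoisyVersion_of_condExp {m d : ℕ} {Ω : Type*} {𝓕 mΩ : MeasurableSpace Ω} {P : Measure Ω}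
    [IsProbabilityMeasure P] (h𝓕 : 𝓕 ≤ mΩ) {G H : Fin m → Ω → EuclideanSpace ℝ (Fin d)} {σ : ℝ}
    (hG : ∀ i, Measurable (G i)) (hH𝓕 : ∀ i, StronglyMeasurable[𝓕] (H i))
    (hH2 : ∀ i, MemLp (H i) 2 P) (hindep : CondIndepGiven P 𝓕 G)
    (hmean : ∀ i, P[G i | 𝓕] =ᵐ[P] H i)
    (hint : ∀ i, Integrable (fun ω => ‖G i ω - H i ω‖ ^ 2) P)
    (hvar : ∀ i, P[fun ω => ‖G i ω - H i ω‖ ^ 2 | 𝓕] ≤ᵐ[P] fun _ => σ ^ 2) :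
    IsNoisyVersion P 𝓕 G H σ := by
  have hN2 : ∀ i, MemLp (fun ω => G i ω - H i ω) 2 P := fun i =>
    (memLp_two_iff_integrable_sq_norm
      ((hG i).aestronglyMeasurable.sub (hH2 i).aestronglyMeasurable)).2 (hint i)
  have hG2 : ∀ i, MemLp (G i) 2 P := fun i => by
    have := (hN2 i).add (hH2 i)
    refine this.congr_norm (hG i).aestronglyMeasurable (Filter.Eventually.of_forall fun ω => ?_)
    simp
  refine ⟨hH𝓕, hH2, hG2, fun i f hf𝓕 hf => ?_, fun i j hij => ?_, fun i => ?_⟩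
  · exact integral_inner_sub_condExp_eq_zero h𝓕 hf𝓕 hf (hG2 i) (hH2 i) (hmean i)
  · exact hindep.integral_inner_sub_eq_zero h𝓕 hG hG2 hH𝓕 hH2 hmean hij
  · rw [← integral_condExp h𝓕]
    refine (integral_mono_ae integrable_condExp (integrable_const _) (hvar i)).trans ?_
    simp

end Matcha

theorem theorem2
    -- the base graph, its matchings, the communication budget and the activation probabilities
    {m M : ℕ} (G : SimpleGraph (Fin m)) (hG : G.Connected)
    (Gs : Fin M → SimpleGraph (Fin m)) (hGs : Matcha.IsMatchingDecomposition G Gs)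
    (Cb : ℝ) (hCb : 0 < Cb)
    (p : Fin M → unitInterval) (hp : Matcha.IsOptimalActivation Gs Cb p)
    -- the sample space, the activations `B k` and the mini-batches `ξ k i`
    {Ω Ξ : Type*} [MeasurableSpace Ω] [MeasurableSpace Ξ] (P : Measure Ω) [IsProbabilityMeasure P]
    (B : ℕ → Ω → Fin M → Bool) (ξ : ℕ → Fin m → Ω → Ξ)
    -- the local objectives, the stochastic gradients and the initial point
    {d : ℕ} (F : Fin m → EuclideanSpace ℝ (Fin d) → ℝ)
    (g : Fin m → EuclideanSpace ℝ (Fin d) → Ξ → EuclideanSpace ℝ (Fin d))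
    (x₁ : EuclideanSpace ℝ (Fin d)) (L σ ζ Finf : ℝ) (hL : 0 ≤ L) (K : ℕ) (hK : 1 ≤ K) :
    -- `ρ < 1` for all small enough positive weights
    (∃ α₀ : ℝ, 0 < α₀ ∧ ∀ α : ℝ, 0 < α → α < α₀ → Matcha.rho Gs p α < 1) ∧
    -- `ρ < 1` for the weight that solves the semidefinite program
    (∀ α : ℝ, Matcha.IsOptimalWeight Gs p α → Matcha.rho Gs p α < 1) ∧
    -- the convergence bound
    (∀ (α η ρ D : ℝ) (Fbar : EuclideanSpace ℝ (Fin d) → ℝ)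
        (x : ℕ → Fin m → Ω → EuclideanSpace ℝ (Fin d)) (xbar : ℕ → Ω → EuclideanSpace ℝ (Fin d)),
      -- abbreviations: spectral norm, `D`, global objective, local models, averaged model
      ρ = Matcha.rho Gs p α →
      D = 6 * η ^ 2 * L ^ 2 * ρ / (1 - √ρ) ^ 2 →
      Fbar = Matcha.globalObj F →
      x = Matcha.iterate g η x₁ (fun k ω => Matcha.mixingMatrix Gs α (B k ω)) ξ →
      xbar = (fun k ω => Matcha.average fun i => x k i ω) →
      -- the weight is such that `ρ < 1`
      ρ < 1 → 0 < η →
      -- step size; for `ρ = 0` the second bound reads `η L ≤ ∞`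
      η * L ≤ 1 → (ρ ≠ 0 → η * L ≤ (√(ρ⁻¹) - 1) / 4) →
      -- measurability
      (∀ i, Measurable (Function.uncurry (g i))) →
      (∀ k < K, ∀ i, Measurable (ξ k i)) →
      (∀ k < K, Measurable (B k)) →
      -- at every iteration the activations are independent Bernoulli variables, independent of the
      -- history (which contains the earlier activations) and of the mini-batches drawn so far
      (∀ k < K, HasLaw (B k) (Matcha.activationLaw p) P) →
      (∀ k < K, Indep (MeasurableSpace.comap (B k) inferInstance)
        (Matcha.historyWithSamples ξ B k) P) →
      -- given the history, the stochastic gradients of the workers are independent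
      (∀ k < K, Matcha.CondIndepGiven P (Matcha.history ξ B k)
        fun i ω => g i (x k i ω) (ξ k i ω)) →
      -- smoothness, with a lower bound of the global objective
      (∀ i, Differentiable ℝ (F i)) →
      (∀ i y z, ‖gradient (F i) y - gradient (F i) z‖ ≤ L * ‖y - z‖) →
      (∀ y, Finf ≤ Fbar y) →
      -- unbiased gradients
      (∀ k < K, ∀ i, Integrable (fun ω => g i (x k i ω) (ξ k i ω)) P) →
      (∀ k < K, ∀ i, P[fun ω => g i (x k i ω) (ξ k i ω) | Matcha.history ξ B k]
        =ᵐ[P] fun ω => gradient (F i) (x k i ω)) →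
      -- bounded variance
      (∀ k < K, ∀ i, Integrable
        (fun ω => ‖g i (x k i ω) (ξ k i ω) - gradient (F i) (x k i ω)‖ ^ 2) P) →
      (∀ k < K, ∀ i,
        P[fun ω => ‖g i (x k i ω) (ξ k i ω) - gradient (F i) (x k i ω)‖ ^ 2 | Matcha.history ξ B k]
        ≤ᵐ[P] fun _ => σ ^ 2) →
      -- bounded gradient dissimilarity
      (∀ y, (1 / (m : ℝ)) * ∑ i, ‖gradient (F i) y - gradient Fbar y‖ ^ 2 ≤ ζ ^ 2) →
      D < 1 / 2 ∧
      (∀ k < K, Integrable (fun ω => ‖gradient Fbar (xbar k ω)‖ ^ 2) P) ∧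
      (1 / (K : ℝ)) * ∑ k ∈ Finset.range K, ∫ ω, ‖gradient Fbar (xbar k ω)‖ ^ 2 ∂P ≤
        (2 * (Fbar x₁ - Finf) / (η * K) + η * L * σ ^ 2 / m) * (1 / (1 - 2 * D)) +
        2 * η ^ 2 * L ^ 2 * ρ / (1 - √ρ) * (σ ^ 2 / (1 + √ρ) + 3 * ζ ^ 2 / (1 - √ρ)) *
          (1 / (1 - 2 * D))) := by
  have : NeZero m := ⟨fun h => by subst h; exact (hG.nonempty.some).elim0⟩
  refine ⟨Matcha.exists_forall_rho_lt_one hG hGs hCb hp,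
    fun α hα => hα.rho_lt_one hG hGs hCb hp, ?_⟩
  intro α η ρ D Fbar x xbar hρ hD hFbar hx hxbar hρ1 hη hηL hηρ hg hξ hB hlaw hind hcond hF hFL hinf
    _ hmean hvint hvar hζ
  have hρ0 : 0 ≤ ρ := hρ ▸ norm_nonneg _
  set s := √ρ with hs
  have hs0 : 0 ≤ s := Real.sqrt_nonneg _
  have hs1 : s < 1 := by
    rw [hs, Real.sqrt_lt' one_pos]
    simpa using hρ1
  have hρs : ρ = s ^ 2 := (Real.sq_sqrt hρ0).symm
  have hstep : s ≠ 0 → η * L ≤ (s⁻¹ - 1) / 4 := by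
    intro h
    have h1 := hηρ fun h0 => h (by rw [hs, h0, Real.sqrt_zero])
    rwa [Real.sqrt_inv] at h1
  have hDlt : D < 1 / 2 := by
    rw [hD, hρs]
    exact Matcha.stepSize_lt_half hs0 hs1 hη hL hstep
  subst hFbar
  have hF' := Matcha.differentiable_globalObj hF
  have hFL' := Matcha.norm_gradient_globalObj_sub_le hF hFL
  have hhist : ∀ k ≤ K, Matcha.history ξ B k ≤ ‹MeasurableSpace Ω› := fun k hk =>
    Matcha.history_le (fun l hl => hξ l (hl.trans_le hk)) fun l hl => hB l (hl.trans_le hk)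
  have hx𝓕 : ∀ k i, StronglyMeasurable[Matcha.history ξ B k] (x k i) := fun k i => by
    rw [hx]
    exact (Matcha.measurable_iterate hg k i).stronglyMeasurable
  set G : ℕ → Fin m → Ω → EuclideanSpace ℝ (Fin d) := fun k i ω => g i (x k i ω) (ξ k i ω) with hG'
  have hG𝓖 : ∀ k i, StronglyMeasurable[Matcha.historyWithSamples ξ B k] (G k i) := fun k i => by
    simp only [hG', hx]
    exact (Matcha.measurable_gradientSample_iterate hg
      (Matcha.measurable_iterate hg k) i).stronglyMeasurable
  have hGm : ∀ k < K, ∀ i, Measurable (G k i) := fun k hk i =>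
    ((hG𝓖 k i).mono ((Matcha.historyWithSamples_le_history_succ ξ B k).trans
      (hhist (k + 1) hk))).measurable
  have hxsucc : ∀ k i, x (k + 1) i = fun ω =>
      ∑ j, Matcha.mixingMatrix Gs α (B k ω) i j • (x k j ω - η • G k j ω) := by
    intro k i
    simp only [hG', hx]
    rfl
  have hnoisy_of : ∀ k < K, (∀ i, MemLp (x k i) 2 P) →
      Matcha.IsNoisyVersion P (Matcha.history ξ B k) (G k)
        (fun i ω => gradient (F i) (x k i ω)) σ := fun k hk hx2 =>
    Matcha.isNoisyVersion_of_condExp (hhist k hk.le) (hGm k hk)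
      (fun i => (Matcha.continuous_of_norm_sub_le hL (hFL i)).comp_stronglyMeasurable (hx𝓕 k i))
      (fun i => Matcha.memLp_comp_of_norm_sub_le hL (hFL i) (hx2 i)) (hcond k hk) (hmean k hk)
      (hvint k hk) (hvar k hk)
  have hx2 : ∀ k ≤ K, ∀ i, MemLp (x k i) 2 P := by
    intro k
    induction k with
    | zero =>
      intro _ i
      rw [hx]
      exact memLp_const x₁
    | succ k ih =>
      intro hk i
      rw [hxsucc]
      exact Matcha.memLp_mixing (hB k hk) (fun j => (ih (Nat.le_of_succ_le hk) j).sub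
        (((hnoisy_of k hk (ih (Nat.le_of_succ_le hk))).memLp j).const_smul η)) i
  have hnoisy := fun k hk => hnoisy_of k hk (hx2 k (Nat.le_of_lt hk))
  have hTint : ∀ k < K, Integrable
      (fun ω => ‖gradient (Matcha.globalObj F) (Matcha.average fun i => x k i ω)‖ ^ 2) P :=
    fun k hk => (Matcha.memLp_comp_of_norm_sub_le hL hFL'
      (Matcha.memLp_average (hx2 k hk.le))).integrable_norm_pow two_ne_zero
  subst hxbar
  refine ⟨hDlt, hTint, ?_⟩
  have hf0 : ∫ ω, Matcha.globalObj F (Matcha.average fun i => x 0 i ω) ∂P =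
      Matcha.globalObj F x₁ := by
    have h0 : ∀ ω, (Matcha.average fun i => x 0 i ω) = x₁ := fun ω => by
      rw [hx]
      exact Matcha.average_const x₁
    simp [h0]
  have hmain := Matcha.average_le_of_recursion (NeZero.pos m) hK
    (Y := fun k => ∫ ω, Matcha.dispersion (fun i => x k i ω) ∂P)
    (T := fun k => ∫ ω, ‖gradient (Matcha.globalObj F) (Matcha.average fun i => x k i ω)‖ ^ 2 ∂P)
    (f := fun k => ∫ ω, Matcha.globalObj F (Matcha.average fun i => x k i ω) ∂P)
    (σ := σ) (ζ := ζ) (Finf := Finf) hs0 hs1 hη hL (Matcha.stepSize_lt_half hs0 hs1 hη hL hstep)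
    ?_ (fun k => integral_nonneg fun ω => Matcha.dispersion_nonneg _) ?_ ?_ ?_ ?_
  · rw [hD, hρs]
    rw [hf0] at hmain
    exact hmain
  · have h0 : ∀ ω, Matcha.dispersion (fun i => x 0 i ω) = 0 := fun ω => by
      rw [hx]
      simp [Matcha.dispersion, Matcha.iterate, Matcha.average_const]
    simp [h0]
  · rw [hf0]
    exact hinf x₁
  · have h1 := integral_mono (integrable_const Finf) (Matcha.integrable_comp_of_memLp hF' hFL' hinf
      (Matcha.memLp_average (hx2 K le_rfl))) fun ω => hinf _
    simpa using h1
  · intro k hk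
    have h1 := (hnoisy k hk).integral_globalObj_le (hx𝓕 k) (hx2 k hk.le) hF hL hFL hinf hη hηL
    refine le_trans (le_of_eq ?_) h1
    congr 1
    funext ω
    simp only [hxsucc]
    rw [Matcha.average_mixing]
  · intro k hk
    have h1 := (hnoisy k hk).integral_dispersion_mixing_le (η := η) (ζ := ζ) (Gs := Gs) (p := p)
      (α := α) (𝓖 := Matcha.historyWithSamples ξ B k) (hx𝓕 k) (hx2 k hk.le) hFL hζ
      (hTint k hk) (hρ ▸ hρ1)
      (fun i => (hx𝓕 k i).mono le_sup_left) (hG𝓖 k) (hB k hk) (hlaw k hk) (hind k hk)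
    rw [← hρ, ← hs] at h1
    simp only [hxsucc]
    rw [← hρs]
    exact h1
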